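/- Let $f,g:\mathbb{R}^n\to[0,+\infty)$ and $h_1,h_2:\mathbb{R}^n\to\mathbb{R}$, where $f$ and $h_2$ are convex and $g$ and $h_1$ are differentiable on $\mathbb{R}^n$ with locally Lipschitz continuous gradients. Let $C\subseteq\mathbb{R}^n$ be closed and convex, put $\Omega:=\{x: g(x)\neq0\}$, and assume $C\cap\Omega\neq\varnothing$. Let $F:\mathbb{R}^n\to(-\infty,+\infty]$ be $$F(x)=\frac{f(x)^2}{g(x)}+h_1(x)-h_2(x)\ \text{ if } x\in\Omega\cap C,\qquad F(x)=+\infty\ \text{ otherwise,}$$ let $\iota_C$ be the indicator function of $C$ ($0$ on $C$, $+\infty$ elsewhere), $h_2^\star(z)=\sup_x\{\langle x,z\rangle-h_2(x)\}$, and let $H:\mathbb{R}^n\times\mathbb{R}^n\times\mathbb{R}\to(-\infty,+\infty]$ be $$H(x,z,c)=2cf(x)+\iota_C(x)-c^2g(x)+h_1(x)+h_2^\star(z)-\langle x,z\rangle .$$ For $\varphi:\mathbb{R}^d\to(-\infty,+\infty]$ and $x\in\mathrm{dom}\,\varphi=\{\varphi<+\infty\}$, the Fréchet subdifferential $\widehat\partial\varphi(x)$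 is the set of $y$ with $\liminf_{z\to x,\,z\ne x}\frac{\varphi(z)-\varphi(x)-\langle y,z-x\rangle}{\|z-x\|_2}\ge0$, and the limiting subdifferential $\partial\varphi(x)$ is the set of all limits $y=\lim y^k$ with $y^k\in\widehat\partial\varphi(u^k)$, $u^k\to x$, $\varphi(u^k)\to\varphi(x)$; both are empty for $x\notin\mathrm{dom}\,\varphi$. The function $\varphi$ is proper if $\mathrm{dom}\,\varphi\neq\varnothing$, and closed if it is lower semicontinuous. A proper $\varphi$ is a KL function if for every $\widehat x$ with $\partial\varphi(\widehat x)\ne\varnothing$ there are $a\in(0,+\infty]$, a neighbourhood $U$ of $\widehat x$, and a continuous concave $\phi:[0,a)\to[0,+\infty)$ with $\phi(0)=0$, continuously differentiable on $(0,a)$ with $\phi'>0$ there, such that $\phi'(\varphi(x)-\varphi(\widehat x))\,\mathrm{dist}(0,\partial\varphi(x))\ge1$ for all $x\in U$ with $\varphi(\widehat x)<\varphi(x)<\varphi(\widehat x)+a$ (where $\mathrm{dist}(0,\varnothing)=+\infty$). Write $\mathrm{prox}_\varphi(x)=\arg\min_y\{\varphi(y)+\frac12\|x-y\|_2^2\}$.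 A point $x^\star\in\Omega\cap C$ is a critical point of $F$ if, with $c_\star=f(x^\star)/g(x^\star)$, $$0\in\partial(2c_\star f+\iota_C)(x^\star)-c_\star^2\nabla g(x^\star)+\nabla h_1(x^\star)-\partial h_2(x^\star).$$ Algorithm. Given $x^0\in\mathrm{dom}\,F$, $0<\underline\alpha<\overline\alpha$, $\sigma>0$, $0<r<1$, for $k=0,1,2,\dots$: put $c_k=f(x^k)/g(x^k)$, choose any $z^k\in\partial h_2(x^k)$ and any $\widetilde\alpha_k\in[\underline\alpha,\overline\alpha]$. For $\alpha=\widetilde\alpha_k,\ \widetilde\alpha_kr,\ \widetilde\alpha_kr^2,\dots$ in turn, compute $$\widehat x^k\in\mathrm{prox}_{2\alpha c_kf+\iota_C}\bigl(x^k-\alpha(\nabla h_1(x^k)-c_k^2\nabla g(x^k)-z^k)\bigr),$$ until for the first time $\widehat x^k\in\Omega$ and $$H\bigl(\widehat x^k,z^k,f(\widehat x^k)/g(\widehat x^k)\bigr)+\tfrac\sigma2\|\widehat x^k-x^k\|_2^2\le F(x^k);$$ then set $x^{k+1}=\widehat x^k$. Theorem. Suppose that the level set $\mathcal X_0=\{x\in\mathrm{dom}\,F:F(x)\le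 F(x^0)\}$ is compact and that $H$ is a proper closed KL function. Then every sequence $\{x^k:k\in\mathbb{N}\}$ generated by the algorithm converges, and its limit is a critical point of $F$. -/

import Mathlib

open Filter Topology

noncomputable section

namespace FracProg

/-! Extended-real-valued functions on a real inner product space are functions to `EReal`;
"proper" includes the requirement that the value `⊥` is never taken. -/

section General

variable {V : Type*} [NormedAddCommGroup V] [InnerProductSpace ℝ V]

/-- A function with values in `(-∞, +∞]` whose domain `{x | φ x < +∞}` is nonempty. -/
def IsProper (φ : V → EReal) : Prop :=
  (∀ x, φ x ≠ ⊥) ∧ ∃ x, φ x < ⊤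

/-- Proper and lower semicontinuous. -/
def IsProperClosed (φ : V → EReal) : Prop :=
  IsProper φ ∧ LowerSemicontinuous φ

open Classical in
/-- The indicator function of a set: `0` on the set and `+∞` off it. -/
def indicatorFn (S : Set V) (x : V) : EReal :=
  if x ∈ S then 0 else ⊤

/-- The Fréchet subdifferential, empty off the domain of `φ`. -/
def frechetSubdiff (φ : V → EReal) (x : V) : Set V :=
  {y | φ x < ⊤ ∧
    0 ≤ liminf (fun z : V =>
      (φ z - φ x - ((inner ℝ y (z - x) : ℝ) : EReal)) / ((‖z - x‖ : ℝ) : EReal)) (𝓝[≠] x)}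

/-- The limiting (Mordukhovich) subdifferential, empty off the domain of `φ`. -/
def limitingSubdiff (φ : V → EReal) (x : V) : Set V :=
  {y | φ x < ⊤ ∧ ∃ (u : ℕ → V) (v : ℕ → V),
    Tendsto u atTop (𝓝 x) ∧ Tendsto (fun k => φ (u k)) atTop (𝓝 (φ x)) ∧
    Tendsto v atTop (𝓝 y) ∧ ∀ k, v k ∈ frechetSubdiff φ (u k)}

/-- The limiting subdifferential of a real-valued function. -/
def realSubdiff (h : V → ℝ) (x : V) : Set V :=
  limitingSubdiff (fun y => (h y : EReal)) x

/-- The Fenchel conjugate of a real-valued function. -/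
def conjugate (h : V → ℝ) (z : V) : EReal :=
  ⨆ x : V, ((inner ℝ x z - h x : ℝ) : EReal)

/-- The proximity operator, as the set of minimizers of `y ↦ φ y + ½‖x - y‖²`. -/
def prox (φ : V → EReal) (x : V) : Set V :=
  {y | ∀ w, φ y + ((1 / 2 * ‖x - y‖ ^ 2 : ℝ) : EReal) ≤
    φ w + ((1 / 2 * ‖x - w‖ ^ 2 : ℝ) : EReal)}

/-- The Kurdyka-Łojasiewicz property of `φ` at `x₀`. The desingularizing function `ψ` only matters
on `[0, a)`. The distance to the empty set is `+∞`. -/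
def KLPropertyAt (φ : V → EReal) (x₀ : V) : Prop :=
  ∃ (a : EReal) (U : Set V) (ψ : ℝ → ℝ),
    0 < a ∧ U ∈ 𝓝 x₀ ∧
    ContinuousOn ψ {t : ℝ | 0 ≤ t ∧ (t : EReal) < a} ∧
    ConcaveOn ℝ {t : ℝ | 0 ≤ t ∧ (t : EReal) < a} ψ ∧
    (∀ t : ℝ, 0 ≤ t → (t : EReal) < a → 0 ≤ ψ t) ∧
    ψ 0 = 0 ∧
    ContDiffOn ℝ 1 ψ {t : ℝ | 0 < t ∧ (t : EReal) < a} ∧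
    (∀ t : ℝ, 0 < t → (t : EReal) < a → 0 < deriv ψ t) ∧
    ∀ x ∈ U, φ x₀ < φ x → φ x < φ x₀ + a →
      1 ≤ ENNReal.ofReal (deriv ψ (φ x - φ x₀).toReal) *
        Metric.infEDist (0 : V) (limitingSubdiff φ x)

/-- A KL function: proper, with the KL property at each point where the limiting subdifferential
is nonempty. -/
def IsKLFunction (φ : V → EReal) : Prop :=
  IsProper φ ∧ ∀ x, (limitingSubdiff φ x).Nonempty → KLPropertyAt φ x

end General

section Problem

variable {n : ℕ}

/-- `ℝⁿ` with the Euclidean norm. -/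
abbrev E (n : ℕ) : Type := EuclideanSpace ℝ (Fin n)

/-- `ℝⁿ × ℝⁿ × ℝ` with the Euclidean norm and inner product. -/
abbrev E3 (n : ℕ) : Type := WithLp 2 (E n × WithLp 2 (E n × ℝ))

/-- `Ω = {x | g x ≠ 0}`. -/
def Omega (g : E n → ℝ) : Set (E n) := {x | g x ≠ 0}

open Classical in
/-- The extended objective: `f²/g + h₁ - h₂` on `Ω ∩ C` and `+∞` elsewhere. -/
def objective (f g h₁ h₂ : E n → ℝ) (C : Set (E n)) (x : E n) : EReal :=
  if x ∈ Omega g ∩ C then ((f x ^ 2 / g x + h₁ x - h₂ x : ℝ) : EReal) else ⊤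

/-- The level set `{x ∈ dom F | F x ≤ F x₀}`. -/
def levelSet (f g h₁ h₂ : E n → ℝ) (C : Set (E n)) (x₀ : E n) : Set (E n) :=
  {x | objective f g h₁ h₂ C x < ⊤ ∧ objective f g h₁ h₂ C x ≤ objective f g h₁ h₂ C x₀}

/-- The function `t f + ι_C`, for a real number `t`. -/
def scaledPlusIndicator (t : ℝ) (f : E n → ℝ) (C : Set (E n)) (x : E n) : EReal :=
  ((t * f x : ℝ) : EReal) + indicatorFn C x

/-- `H(x, z, c) = 2 c f(x) + ι_C(x) - c² g(x) + h₁(x) + h₂^*(z) - ⟨x, z⟩`. -/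
def auxH (f g h₁ h₂ : E n → ℝ) (C : Set (E n)) (x z : E n) (c : ℝ) : EReal :=
  scaledPlusIndicator (2 * c) f C x - ((c ^ 2 * g x : ℝ) : EReal) + (h₁ x : EReal) +
    conjugate h₂ z - ((inner ℝ x z : ℝ) : EReal)

/-- `H` as a function of one variable in the Euclidean space `ℝⁿ × ℝⁿ × ℝ`. -/
def auxH3 (f g h₁ h₂ : E n → ℝ) (C : Set (E n)) (p : E3 n) : EReal :=
  auxH f g h₁ h₂ C p.fst p.snd.fst p.snd.snd

/-- `x` is a critical point of `F`: `x ∈ Ω ∩ C` and, with `c = f x / g x`,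
`0 ∈ ∂(2 c f + ι_C)(x) - c² ∇g(x) + ∇h₁(x) - ∂h₂(x)`. -/
def IsCriticalPoint (f g h₁ h₂ : E n → ℝ) (C : Set (E n)) (x : E n) : Prop :=
  x ∈ Omega g ∩ C ∧
    ∃ u ∈ limitingSubdiff (scaledPlusIndicator (2 * (f x / g x)) f C) x,
      ∃ z ∈ realSubdiff h₂ x,
        0 = u - (f x / g x) ^ 2 • gradient g x + gradient h₁ x - z

/-- The acceptance test of the line search at the current iterate `x` with subgradient `z`, for
the trial point `w`. -/
def Accepts (f g h₁ h₂ : E n → ℝ) (C : Set (E n)) (σ : ℝ) (x z w : E n) : Prop :=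
  w ∈ Omega g ∧
    auxH f g h₁ h₂ C w z (f w / g w) + ((σ / 2 * ‖w - x‖ ^ 2 : ℝ) : EReal) ≤
      objective f g h₁ h₂ C x

/-- `x`, `z`, `c` are the sequences produced by an infinite run of the algorithm with parameters
`αlo`, `αhi`, `σ`, `r`. In iteration `k` the line search starts from the stepsize `αinit k`; the
trial point number `j` is `xhat k j`, computed with the stepsize `αinit k * r ^ j`; the trial
points number `0, …, m k - 1` are rejected and the trial point number `m k` is accepted. -/
structure IsRun (f g h₁ h₂ : E n → ℝ) (C : Set (E n)) (αlo αhi σ r : ℝ)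
    (x z : ℕ → E n) (c αinit : ℕ → ℝ) (m : ℕ → ℕ) (xhat : ℕ → ℕ → E n) : Prop where
  init_mem_dom : objective f g h₁ h₂ C (x 0) < ⊤
  c_eq : ∀ k, c k = f (x k) / g (x k)
  z_mem : ∀ k, z k ∈ realSubdiff h₂ (x k)
  αinit_mem : ∀ k, αinit k ∈ Set.Icc αlo αhi
  trial : ∀ k, ∀ j ≤ m k,
    xhat k j ∈ prox (scaledPlusIndicator (2 * (αinit k * r ^ j) * c k) f C)
      (x k - (αinit k * r ^ j) •
        (gradient h₁ (x k) - (c k) ^ 2 • gradient g (x k) - z k))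
  rejected : ∀ k, ∀ j < m k, ¬ Accepts f g h₁ h₂ C σ (x k) (z k) (xhat k j)
  accepted : ∀ k, Accepts f g h₁ h₂ C σ (x k) (z k) (xhat k (m k))
  next : ∀ k, x (k + 1) = xhat k (m k)

/-- The sequence `x` is generated by the algorithm with parameters `αlo`, `αhi`, `σ`, `r`, for
some admissible choices of subgradients and initial stepsizes. -/
def IsGenerated (f g h₁ h₂ : E n → ℝ) (C : Set (E n)) (αlo αhi σ r : ℝ) (x : ℕ → E n) : Prop :=
  ∃ (z : ℕ → E n) (c αinit : ℕ → ℝ) (m : ℕ → ℕ) (xhat : ℕ → ℕ → E n),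
    IsRun f g h₁ h₂ C αlo αhi σ r x z c αinit m xhat

end Problem

end FracProg

end

/-! The nonconvex terms of `F` are unfolded by two dualities. Where `g > 0`, `f² / g` is the maximum
over `c` of `2 c f - c² g`, attained at `c = f / g`; and `-h₂ x` is the minimum over `z` of `h₂^*(z)
- ⟨x, z⟩`, attained at the subgradients of `h₂` at `x`. Put `ζ_k = (x_{k+1}, z_k, c_{k+1})` and `d_k
= ‖x_{k+1} - x_k‖`. The acceptance test and the Fenchel-Young inequality give `H(ζ_{k+1}) + σ/2
d_{k+1}² ≤ F(x_{k+1}) ≤ H(ζ_k)`. So the iterates stay in the compact level set, where `g` is bounded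
below and all Lipschitz constants are uniform (`exists_uniformBounds`).

At `ζ_k`, `H` has a Fréchet subgradient of norm `O(d_k)` (`mem_frechetSubdiff_auxH3`,
`UniformBounds.exists_subgradient_norm_le`): the `c`-component `2 (f - c g)` vanishes, the
`z`-component is `x_k - x_{k+1}`, and the `x`-component comes from the optimality of the proximal
step. The latter contains `1/α`, so accepted stepsizes must stay away from zero. They do
(`IsRun.exists_le_stepsize`): a proximal step with stepsize `α` has length `O(α)` and lowers the
model by at least `‖step‖² / (2α)`, while every model error is `O(‖step‖²)`.

Decrease, relative error and the KL inequality at the cluster points of `ζ` combine into `d_{k+1}² ≤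
const · (Ψ_k - Ψ_{k+1}) d_k` with `Ψ` nonincreasing and nonnegative, hence `∑ d_k < ∞`
(`summable_of_forall_cluster_KLPropertyAt`). Thus `x` converges, and the optimality conditions pass
to the limit along a subsequence on which `z` converges too. -/

namespace FracProg

/-! ### Fréchet, limiting and convex subgradients. -/

section Subgradient

variable {V : Type*} [NormedAddCommGroup V] [InnerProductSpace ℝ V]

/-- `v` is a subgradient at `x` of the convex-analysis kind, tested against the points of `C`. -/
def HasSubgradientOn (f : V → ℝ) (C : Set V) (v x : V) : Prop :=
  ∀ y ∈ C, f x + inner ℝ v (y - x) ≤ f y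

/-- Every Fréchet subgradient exhibited below goes through this real ε-inequality, which avoids the
`EReal` quotient. Where `φ z = ⊤` the quotient is `⊤`. -/
theorem mem_frechetSubdiff_of_eventually_le {φ : V → EReal} {x y : V} {a : ℝ}
    (hx : φ x = a)
    (h : ∀ ε : ℝ, 0 < ε → ∀ᶠ z in 𝓝 x,
      ((a + inner ℝ y (z - x) - ε * ‖z - x‖ : ℝ) : EReal) ≤ φ z) :
    y ∈ frechetSubdiff φ x := by
  refine ⟨by rw [hx]; exact EReal.coe_lt_top a, ?_⟩
  have key : ∀ ε : ℝ, 0 < ε → ((-ε : ℝ) : EReal) ≤ liminf (fun z : V =>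
      (φ z - φ x - ((inner ℝ y (z - x) : ℝ) : EReal)) / ((‖z - x‖ : ℝ) : EReal)) (𝓝[≠] x) := by
    intro ε hε
    refine le_liminf_of_le (by isBoundedDefault) ?_
    filter_upwards [(h ε hε).filter_mono nhdsWithin_le_nhds, self_mem_nhdsWithin] with z hz hne
    have hpos : 0 < ‖z - x‖ := norm_pos_iff.2 (sub_ne_zero.2 hne)
    rw [hx]
    induction hφ : φ z using EReal.rec with
    | bot => rw [hφ] at hz; exact absurd (le_bot_iff.1 hz) (EReal.coe_ne_bot _)
    | top =>
      have : (⊤ : EReal) - (a : EReal) - ((inner ℝ y (z - x) : ℝ) : EReal) = ⊤ := rfl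
      rw [this, EReal.top_div_of_pos_ne_top (by exact_mod_cast hpos) (EReal.coe_ne_top _)]
      exact le_top
    | coe b =>
      rw [hφ] at hz
      rw [← EReal.coe_sub, ← EReal.coe_sub, ← EReal.coe_div]
      have hz' := EReal.coe_le_coe_iff.1 hz
      rw [EReal.coe_le_coe_iff, le_div_iff₀ hpos]
      linarith
  refine EReal.ge_of_forall_gt_iff_ge.1 fun t ht => ?_
  have ht' : t < 0 := by exact_mod_cast ht
  simpa using key (-t) (by linarith)

theorem mem_limitingSubdiff_of_mem_frechetSubdiff {φ : V → EReal} {x y : V}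
    (h : y ∈ frechetSubdiff φ x) : y ∈ limitingSubdiff φ x :=
  ⟨h.1, fun _ => x, fun _ => y, tendsto_const_nhds, tendsto_const_nhds, tendsto_const_nhds,
    fun _ => h⟩

/-- The local inequality, applied at `x + t (w - x)` for one small `t > 0`, scales up to `w` by
convexity. -/
theorem hasSubgradientOn_of_mem_frechetSubdiff {h : V → ℝ} (hh : ConvexOn ℝ Set.univ h) {x v : V}
    (hv : v ∈ frechetSubdiff (fun y => (h y : EReal)) x) : HasSubgradientOn h Set.univ v x := by
  intro w _
  by_cases hw : w = x
  · simp [hw]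
  have hpos : 0 < ‖w - x‖ := norm_pos_iff.2 (sub_ne_zero.2 hw)
  have key : ∀ ε : ℝ, 0 < ε → h x + inner ℝ v (w - x) ≤ h w + ε * ‖w - x‖ := by
    intro ε hε
    have h1 : ∀ᶠ z in 𝓝[≠] x, ((-ε : ℝ) : EReal) <
        (((h z : ℝ) : EReal) - h x - ((inner ℝ v (z - x) : ℝ) : EReal)) /
          ((‖z - x‖ : ℝ) : EReal) := by
      refine eventually_lt_of_lt_liminf (lt_of_lt_of_le ?_ hv.2)
      exact_mod_cast (neg_lt_zero.2 hε)
    have h2 : Tendsto (fun t : ℝ => x + t • (w - x)) (𝓝[>] 0) (𝓝[≠] x) := by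
      refine tendsto_nhdsWithin_iff.2 ⟨?_, ?_⟩
      · have : Continuous (fun t : ℝ => x + t • (w - x)) := by fun_prop
        have := this.tendsto 0
        simp only [zero_smul, add_zero] at this
        exact this.mono_left nhdsWithin_le_nhds
      · filter_upwards [self_mem_nhdsWithin] with t ht
        simp [(show (0:ℝ) < t from ht).ne', sub_ne_zero.2 hw]
    have h3 : ∀ᶠ t : ℝ in 𝓝[>] 0, t < 1 :=
      (gt_mem_nhds (by norm_num : (0:ℝ) < 1)).filter_mono nhdsWithin_le_nhds
    obtain ⟨t, ⟨ht1, ht2⟩, ht0⟩ := (((h2.eventually h1).and h3).and self_mem_nhdsWithin).exists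
    have ht0 : 0 < t := ht0
    rw [← EReal.coe_sub, ← EReal.coe_sub, ← EReal.coe_div, EReal.coe_lt_coe_iff] at ht1
    have e : x + t • (w - x) - x = t • (w - x) := by abel
    rw [e, norm_smul, Real.norm_of_nonneg ht0.le, inner_smul_right,
      lt_div_iff₀ (by positivity)] at ht1
    have hc := hh.2 (Set.mem_univ x) (Set.mem_univ w) (sub_nonneg.2 ht2.le) ht0.le (by ring)
    have e2 : (1 - t) • x + t • w = x + t • (w - x) := by
      rw [sub_smul, smul_sub, one_smul]; abel
    rw [e2] at hc
    simp only [smul_eq_mul] at hc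
    have : t * (h x + inner ℝ v (w - x)) ≤ t * (h w + ε * ‖w - x‖) := by nlinarith
    exact le_of_mul_le_mul_left this ht0
  refine le_of_forall_pos_le_add fun δ hδ => ?_
  have := key (δ / ‖w - x‖) (by positivity)
  rwa [div_mul_cancel₀ _ hpos.ne'] at this

theorem HasSubgradientOn.of_tendsto {h : V → ℝ} {C : Set V} {u v : ℕ → V} {x y : V}
    (hu : Tendsto u atTop (𝓝 x)) (hhu : Tendsto (fun k => h (u k)) atTop (𝓝 (h x)))
    (hv : Tendsto v atTop (𝓝 y)) (H : ∀ k, HasSubgradientOn h C (v k) (u k)) :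
    HasSubgradientOn h C y x := fun w hw =>
  le_of_tendsto (hhu.add (hv.inner (tendsto_const_nhds.sub hu))) (Eventually.of_forall fun k =>
    H k w hw)

theorem hasSubgradientOn_of_mem_realSubdiff {h : V → ℝ} (hh : ConvexOn ℝ Set.univ h) {x v : V}
    (hv : v ∈ realSubdiff h x) : HasSubgradientOn h Set.univ v x := by
  obtain ⟨-, u, w, hu, hhu, hw, H⟩ := hv
  exact .of_tendsto hu (EReal.tendsto_coe.1 hhu) hw
    fun k => hasSubgradientOn_of_mem_frechetSubdiff hh (H k)

theorem mem_realSubdiff_of_hasSubgradientOn {h : V → ℝ} {x v : V}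
    (hv : HasSubgradientOn h Set.univ v x) : v ∈ realSubdiff h x := by
  refine mem_limitingSubdiff_of_mem_frechetSubdiff
    (mem_frechetSubdiff_of_eventually_le rfl fun ε hε => Eventually.of_forall fun z => ?_)
  have := hv z (Set.mem_univ z)
  have : 0 ≤ ε * ‖z - x‖ := by positivity
  exact EReal.coe_le_coe_iff.2 (by linarith)

theorem conjugate_ge (h : V → ℝ) (x z : V) :
    ((inner ℝ x z - h x : ℝ) : EReal) ≤ conjugate h z :=
  le_iSup (fun x : V => ((inner ℝ x z - h x : ℝ) : EReal)) x

theorem conjugate_eq_of_hasSubgradientOn {h : V → ℝ} {x z : V}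
    (hz : HasSubgradientOn h Set.univ z x) :
    conjugate h z = ((inner ℝ x z - h x : ℝ) : EReal) := by
  refine le_antisymm (iSup_le fun y => ?_) (conjugate_ge h x z)
  have := hz y (Set.mem_univ y)
  rw [inner_sub_right, real_inner_comm y z, real_inner_comm x z] at this
  exact EReal.coe_le_coe_iff.2 (by linarith)

/-- Subgradients are bounded by a Lipschitz constant near the point. -/
theorem HasSubgradientOn.norm_le {h : V → ℝ} {x v : V} {L ρ : ℝ} (hρ : 0 < ρ) (hL : 0 ≤ L)
    (hv : HasSubgradientOn h Set.univ v x)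
    (hlip : ∀ y, ‖y - x‖ ≤ ρ → h y - h x ≤ L * ‖y - x‖) : ‖v‖ ≤ L := by
  by_cases hv0 : v = 0
  · simpa [hv0] using hL
  have hn : 0 < ‖v‖ := norm_pos_iff.2 hv0
  have e : x + (ρ / ‖v‖) • v - x = (ρ / ‖v‖) • v := by abel
  have en : ‖(ρ / ‖v‖) • v‖ = ρ := by
    rw [norm_smul, Real.norm_of_nonneg (by positivity), div_mul_cancel₀ _ hn.ne']
  have h1 := hv (x + (ρ / ‖v‖) • v) (Set.mem_univ _)
  have h2 := hlip (x + (ρ / ‖v‖) • v) (by rw [e, en])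
  rw [e, inner_smul_right, real_inner_self_eq_norm_sq] at h1
  rw [e, en] at h2
  have : ρ / ‖v‖ * ‖v‖ ^ 2 = ρ * ‖v‖ := by field_simp
  rw [this] at h1
  have : ρ * ‖v‖ ≤ ρ * L := by linarith
  exact le_of_mul_le_mul_left this hρ

/-- The sum rule for a continuous convex function and the indicator of a convex set. -/
theorem HasSubgradientOn.exists_add_normal [CompleteSpace V] {f : V → ℝ} {C : Set V} {p x : V}
    (hf : ConvexOn ℝ Set.univ f)
    (hfc : Continuous f) (hC : Convex ℝ C) (hx : x ∈ C) (hp : HasSubgradientOn f C p x) :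
    ∃ v, HasSubgradientOn f Set.univ v x ∧ ∀ y ∈ C, inner ℝ (p - v) (y - x) ≤ (0 : ℝ) := by
  -- `q` is convex, nonnegative on `C` and zero at `x`, so its open strict epigraph can be separated
  -- from `C × (-∞, 0]`.
  let q : V → ℝ := fun y => f y - f x - inner ℝ p (y - x)
  have hqc : Continuous q := by fun_prop
  have hq : ConvexOn ℝ Set.univ q := by
    refine ⟨convex_univ, fun a _ b _ s t hs ht hst => ?_⟩
    have h1 := hf.2 (Set.mem_univ a) (Set.mem_univ b) hs ht hst
    simp only [smul_eq_mul] at h1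
    simp only [q, smul_eq_mul, inner_sub_right, inner_add_right, inner_smul_right]
    obtain rfl : t = 1 - s := by linarith
    nlinarith
  have hdisj : Disjoint {z : V × ℝ | z.1 ∈ Set.univ ∧ q z.1 < z.2} (C ×ˢ Set.Iic (0 : ℝ)) := by
    rw [Set.disjoint_left]
    rintro ⟨y, s⟩ ⟨-, h1⟩ ⟨h2, h3⟩
    have := hp y h2
    simp only [Set.mem_Iic, q] at h1 h3
    linarith
  have hopen : IsOpen {z : V × ℝ | z.1 ∈ Set.univ ∧ q z.1 < z.2} := by
    simp only [Set.mem_univ, true_and]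
    exact isOpen_lt (hqc.comp continuous_fst) continuous_snd
  obtain ⟨l, u, h1, h2⟩ := geometric_hahn_banach_open hq.convex_strict_epigraph hopen
    (hC.prod (convex_Iic (0 : ℝ))) hdisj
  have hl : ∀ y s, l (y, s) = l (y, 0) + s * l (0, 1) := by
    intro y s
    have : ((y, s) : V × ℝ) = (y, 0) + s • (0, 1) := by ext <;> simp
    rw [this, map_add, map_smul, smul_eq_mul]
  have hqx : q x = 0 := by simp [q]
  -- The hyperplane is not vertical: `(x, 1)` and `(x, 0)` lie strictly above and below it in this
  -- direction. Finiteness of `f` at `x` replaces a constraint qualification.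
  have hb : l (0, 1) < 0 := by
    have a1 := h1 (x, 1) ⟨Set.mem_univ _, by simp [hqx]⟩
    have a2 := h2 (x, 0) ⟨hx, by simp⟩
    rw [hl] at a1
    linarith
  set b := l (0, 1) with hbdef
  have hbne : b ≠ 0 := hb.ne
  -- the limit form of the first separation inequality
  have h1' : ∀ y, l (y, 0) + q y * b ≤ u := by
    intro y
    refine le_of_forall_pos_le_add fun δ hδ => ?_
    have := h1 (y, q y + δ / (-b)) ⟨Set.mem_univ _, by
      have : 0 < δ / (-b) := div_pos hδ (by linarith)
      simpa using this⟩
    rw [hl, add_mul] at this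
    have e : δ / (-b) * b = -δ := by field_simp
    rw [e] at this
    linarith
  have h2' : ∀ y ∈ C, u ≤ l (y, 0) := fun y hy => h2 (y, 0) ⟨hy, by simp⟩
  have hu : u = l (x, 0) := by
    have a1 := h1' x
    have a2 := h2' x hx
    rw [hqx] at a1
    linarith
  let a : V := (InnerProductSpace.toDual ℝ V).symm (l.comp (ContinuousLinearMap.inl ℝ V ℝ))
  have ha : ∀ y, inner ℝ a y = l (y, 0) := by
    intro y
    simp [a, InnerProductSpace.toDual_symm_apply]
  have hasub : ∀ y, inner ℝ a (y - x) = l (y, 0) - l (x, 0) := by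
    intro y
    rw [inner_sub_right, ha, ha]
  -- Dividing by `-b > 0` normalises the vertical coefficient: the horizontal part of `l` becomes a
  -- subgradient of `q`, and its negative is normal to `C`.
  refine ⟨p + (-b⁻¹) • a, fun y _ => ?_, fun y hy => ?_⟩
  · rw [inner_add_left, real_inner_smul_left, hasub]
    have a1 := h1' y
    rw [hu] at a1
    have a3 : l (y, 0) - l (x, 0) ≤ (-b) * q y := by linarith
    have a4 : (-b⁻¹) * (l (y, 0) - l (x, 0)) ≤ (-b⁻¹) * ((-b) * q y) :=
      mul_le_mul_of_nonneg_left a3 (by have := inv_lt_zero.2 hb; linarith)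
    have e : (-b⁻¹) * ((-b) * q y) = q y := by field_simp
    rw [e] at a4
    simp only [q] at a4
    linarith
  · have e : p - (p + (-b⁻¹) • a) = b⁻¹ • a := by rw [neg_smul]; abel
    rw [e, real_inner_smul_left, hasub]
    have a2 := h2' y hy
    exact mul_nonpos_of_nonpos_of_nonneg (inv_lt_zero.2 hb).le (by linarith)

theorem exists_hasSubgradientOn_univ [CompleteSpace V] {f : V → ℝ}
    (hf : ConvexOn ℝ Set.univ f) (hfc : Continuous f) (x : V) :
    ∃ v, HasSubgradientOn f Set.univ v x := by
  obtain ⟨v, hv, -⟩ := HasSubgradientOn.exists_add_normal (C := {x}) (p := 0) hf hfc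
    (convex_singleton x) rfl (by rintro y rfl; simp)
  exact ⟨v, hv⟩

/-- A subgradient of `t f + ι_C` with `t ≥ 0` splits as `t v` plus a normal vector. -/
theorem HasSubgradientOn.exists_smul_add_normal [CompleteSpace V] {f : V → ℝ} {C : Set V}
    {p x : V} {t : ℝ} (ht : 0 ≤ t) (hf : ConvexOn ℝ Set.univ f)
    (hfc : Continuous f) (hC : Convex ℝ C) (hx : x ∈ C)
    (hp : HasSubgradientOn (fun y => t * f y) C p x) :
    ∃ v, HasSubgradientOn f Set.univ v x ∧ ∀ y ∈ C, inner ℝ (p - t • v) (y - x) ≤ (0 : ℝ) := by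
  -- For `t = 0` the vector `p` is itself normal and any subgradient `v` of `f` serves. This case
  -- occurs when `f` vanishes at an iterate.
  rcases ht.eq_or_lt with rfl | ht
  · obtain ⟨v, hv⟩ := exists_hasSubgradientOn_univ hf hfc x
    refine ⟨v, hv, fun y hy => ?_⟩
    have := hp y hy
    simpa using this
  · obtain ⟨v, hv, hn⟩ := hp.exists_add_normal (hf.smul ht.le) (by fun_prop) hC hx
    refine ⟨t⁻¹ • v, fun y hy => ?_, fun y hy => ?_⟩
    · have := hv y hy
      rw [real_inner_smul_left]
      have h2 : t⁻¹ * (t * f x + inner ℝ v (y - x)) ≤ t⁻¹ * (t * f y) :=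
        mul_le_mul_of_nonneg_left this (by positivity)
      rwa [mul_add, inv_mul_cancel_left₀ ht.ne', inv_mul_cancel_left₀ ht.ne'] at h2
    · rw [smul_inv_smul₀ ht.ne']
      exact hn y hy

/-- First-order optimality for the minimization of a convex function plus `½‖x - ·‖²`. -/
theorem hasSubgradientOn_of_forall_le {φ : V → ℝ} {C : Set V} {x y : V}
    (hφ : ConvexOn ℝ Set.univ φ) (hC : Convex ℝ C) (hy : y ∈ C)
    (h : ∀ w ∈ C, φ y + 1 / 2 * ‖x - y‖ ^ 2 ≤ φ w + 1 / 2 * ‖x - w‖ ^ 2) :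
    HasSubgradientOn φ C (x - y) y := by
  intro w hw
  have key : ∀ t : ℝ, 0 < t → t < 1 →
      φ y + inner ℝ (x - y) (w - y) ≤ φ w + t * (1 / 2 * ‖w - y‖ ^ 2) := by
    intro t ht0 ht1
    have e2 : (1 - t) • y + t • w = y + t • (w - y) := by
      rw [sub_smul, smul_sub, one_smul]; abel
    have hm : (1 - t) • y + t • w ∈ C := hC hy hw (sub_nonneg.2 ht1.le) ht0.le (by ring)
    have hc := hφ.2 (Set.mem_univ y) (Set.mem_univ w) (sub_nonneg.2 ht1.le) ht0.le (by ring)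
    have h1 := h _ hm
    rw [e2] at h1 hc
    have e3 : x - (y + t • (w - y)) = (x - y) - t • (w - y) := by abel
    rw [e3, norm_sub_sq_real (x - y), norm_smul, Real.norm_of_nonneg ht0.le, inner_smul_right] at h1
    simp only [smul_eq_mul] at hc
    have : t * (φ y + inner ℝ (x - y) (w - y)) ≤ t * (φ w + t * (1 / 2 * ‖w - y‖ ^ 2)) := by
      nlinarith
    exact le_of_mul_le_mul_left this ht0
  have hlim : Tendsto (fun t : ℝ => φ w + t * (1 / 2 * ‖w - y‖ ^ 2)) (𝓝[>] 0) (𝓝 (φ w)) := by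
    have : Continuous (fun t : ℝ => φ w + t * (1 / 2 * ‖w - y‖ ^ 2)) := by fun_prop
    have := this.tendsto 0
    simp only [zero_mul, add_zero] at this
    exact this.mono_left nhdsWithin_le_nhds
  refine ge_of_tendsto hlim ?_
  filter_upwards [self_mem_nhdsWithin, (gt_mem_nhds (by norm_num : (0:ℝ) < 1)).filter_mono
    nhdsWithin_le_nhds] with t ht0 ht1
  exact key t ht0 ht1

end Subgradient

section Indicator

variable {n : ℕ}

theorem scaledPlusIndicator_of_mem {t : ℝ} {f : E n → ℝ} {C : Set (E n)} {x : E n} (hx : x ∈ C) :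
    scaledPlusIndicator t f C x = ((t * f x : ℝ) : EReal) := by
  simp [scaledPlusIndicator, indicatorFn, hx]

theorem scaledPlusIndicator_of_notMem {t : ℝ} {f : E n → ℝ} {C : Set (E n)} {x : E n}
    (hx : x ∉ C) : scaledPlusIndicator t f C x = ⊤ := by
  simp only [scaledPlusIndicator, indicatorFn, hx, if_false]
  rfl

theorem mem_limitingSubdiff_scaledPlusIndicator {t : ℝ} {f : E n → ℝ} {C : Set (E n)} {x p : E n}
    (hx : x ∈ C) (hp : HasSubgradientOn (fun y => t * f y) C p x) :
    p ∈ limitingSubdiff (scaledPlusIndicator t f C) x := by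
  refine mem_limitingSubdiff_of_mem_frechetSubdiff
    (mem_frechetSubdiff_of_eventually_le (scaledPlusIndicator_of_mem hx)
      fun ε hε => Eventually.of_forall fun z => ?_)
  by_cases hz : z ∈ C
  · rw [scaledPlusIndicator_of_mem hz]
    have := hp z hz
    have : 0 ≤ ε * ‖z - x‖ := by positivity
    exact EReal.coe_le_coe_iff.2 (by linarith)
  · rw [scaledPlusIndicator_of_notMem hz]
    exact le_top

theorem mem_of_mem_prox_scaledPlusIndicator {t : ℝ} {f : E n → ℝ} {C : Set (E n)} {x y : E n}
    (hC : C.Nonempty) (hy : y ∈ prox (scaledPlusIndicator t f C) x) : y ∈ C := by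
  by_contra hyC
  obtain ⟨w, hw⟩ := hC
  have := hy w
  rw [scaledPlusIndicator_of_notMem hyC, scaledPlusIndicator_of_mem hw, ← EReal.coe_add,
    EReal.top_add_coe] at this
  exact absurd (top_le_iff.1 this) (EReal.coe_ne_top _)

theorem le_of_mem_prox_scaledPlusIndicator {t : ℝ} {f : E n → ℝ} {C : Set (E n)} {x y w : E n}
    (hy : y ∈ prox (scaledPlusIndicator t f C) x) (hyC : y ∈ C) (hw : w ∈ C) :
    t * f y + 1 / 2 * ‖x - y‖ ^ 2 ≤ t * f w + 1 / 2 * ‖x - w‖ ^ 2 := by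
  have := hy w
  rw [scaledPlusIndicator_of_mem hyC, scaledPlusIndicator_of_mem hw, ← EReal.coe_add,
    ← EReal.coe_add] at this
  exact EReal.coe_le_coe_iff.1 this

end Indicator

end FracProg

/-! ### Finite length from the Kurdyka-Łojasiewicz inequality. -/

namespace FracProg

/-- Concavity estimate for a desingularizing function. -/
theorem deriv_mul_sub_le_of_concaveOn {ψ : ℝ → ℝ} {a : EReal}
    (hψ : ConcaveOn ℝ {t : ℝ | 0 ≤ t ∧ (t : EReal) < a} ψ) {s t : ℝ} (hs : 0 ≤ s) (hst : s ≤ t)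
    (hta : (t : EReal) < a) (hd : 0 < t → 0 < deriv ψ t) :
    deriv ψ t * (t - s) ≤ ψ t - ψ s := by
  rcases hst.eq_or_lt with rfl | hlt
  · simp
  have ht : 0 < t := hs.trans_lt hlt
  have h := hψ.deriv_le_slope (x := s) (y := t)
    ⟨hs, lt_of_le_of_lt (EReal.coe_le_coe_iff.2 hst) hta⟩ ⟨ht.le, hta⟩ hlt
    (differentiableAt_of_deriv_ne_zero (hd ht).ne')
  rwa [slope_def_field, le_div_iff₀ (sub_pos.2 hlt)] at h

/-- A sequence with `d_{k+1}² ≤ C Δ_k d_k`, where `Δ` telescopes, is summable. -/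
theorem summable_of_sq_le_telescoping {d Ψ : ℕ → ℝ} {C : ℝ} (hC : 0 ≤ C) (hd : ∀ k, 0 ≤ d k)
    (hΨ : ∀ k, 0 ≤ Ψ k) (hanti : ∀ k, Ψ (k + 1) ≤ Ψ k)
    (h : ∀ k, d (k + 1) ^ 2 ≤ C * (Ψ k - Ψ (k + 1)) * d k) : Summable d := by
  -- Arithmetic-geometric mean: `2 √(d_k · CΔ_k) ≤ d_k + CΔ_k`.
  have step : ∀ k, 2 * d (k + 1) ≤ d k + C * (Ψ k - Ψ (k + 1)) := by
    intro k
    have h0 : 0 ≤ C * (Ψ k - Ψ (k + 1)) := mul_nonneg hC (by linarith [hanti k])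
    refine abs_le_of_sq_le_sq' ?_ (add_nonneg (hd k) h0) |>.2
    nlinarith [h k, sq_nonneg (d k - C * (Ψ k - Ψ (k + 1)))]
  -- Of the two copies of `d (k + 1)` in `step`, one is summed and the other cancels the `d k` of
  -- the next index; only `d N` is left over.
  have key : ∀ N, ∑ k ∈ Finset.range N, d (k + 1) + d N + C * Ψ N ≤ d 0 + C * Ψ 0 := by
    intro N
    induction N with
    | zero => simp
    | succ N ih =>
      rw [Finset.sum_range_succ]
      have := step N
      nlinarith
  refine (summable_nat_add_iff 1).1 (summable_of_sum_range_le (fun k => hd (k + 1))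
    (c := d 0 + C * Ψ 0) fun N => ?_)
  have := key N
  have := hd N
  have := mul_nonneg hC (hΨ N)
  linarith

variable {V : Type*} [NormedAddCommGroup V] [InnerProductSpace ℝ V]

/-- Finite length of a sequence along which a function with the Kurdyka-Łojasiewicz property at
all cluster points decreases sufficiently. -/
theorem summable_of_forall_cluster_KLPropertyAt {φ : V → EReal} {ζ : ℕ → V} {K : Set V}
    (hK : IsCompact K) (hζK : ∀ k, ζ k ∈ K) {η d : ℕ → ℝ} (hη : ∀ k, φ (ζ k) = η k) {l : ℝ}
    (hlim : Tendsto η atTop (𝓝 l)) (hd : ∀ k, 0 ≤ d k) {s M : ℝ} (hs : 0 < s) (hM : 0 < M)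
    (hdesc : ∀ k, η (k + 1) + s * d (k + 1) ^ 2 ≤ η k)
    (hsub : ∀ k, Metric.infEDist (0 : V) (limitingSubdiff φ (ζ k)) ≤ ENNReal.ofReal (M * d k))
    (hcl : ∀ p, MapClusterPt p atTop ζ → φ p = l ∧ KLPropertyAt φ p) : Summable d := by
  have hanti : Antitone η := antitone_nat_of_succ_le fun k => by
    have := hdesc k
    have : 0 ≤ s * d (k + 1) ^ 2 := by positivity
    linarith
  have hge : ∀ k, l ≤ η k := fun k => hanti.le_of_tendsto hlim k
  let Γ : Set V := {p | MapClusterPt p atTop ζ}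
  have hΓ : IsCompact Γ := by
    refine hK.of_isClosed_subset ?_ ?_
    · exact isClosed_setOfPred_clusterPt
    · intro p hp
      exact hK.isClosed.mem_of_mapClusterPt hp (Eventually.of_forall hζK)
  choose! a U ψ ha hU hψc hψconc hψ0 hψz hψC hψd hψKL using fun p (hp : p ∈ Γ) => (hcl p hp).2
  obtain ⟨T, hTΓ, hT⟩ := hΓ.elim_nhds_subcover (fun p => interior (U p))
    (fun p hp => interior_mem_nhds.2 (hU p hp))
  have hO : IsOpen (⋃ p ∈ T, interior (U p)) := isOpen_biUnion fun _ _ => isOpen_interior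
  -- Otherwise compactness of `K` would give a cluster point outside the cover of the cluster set.
  have hev : ∀ᶠ k in atTop, ζ k ∈ ⋃ p ∈ T, interior (U p) := by
    by_contra hne
    have hfr : ∃ᶠ k in atTop, ζ k ∈ K ∩ (⋃ p ∈ T, interior (U p))ᶜ :=
      (not_eventually.1 hne).mono fun k hk => ⟨hζK k, hk⟩
    obtain ⟨p, hp, hcp⟩ := (hK.inter_right hO.isClosed_compl).exists_mapClusterPt_of_frequently hfr
    exact hp.2 (hT hcp)
  have heva : ∀ᶠ k in atTop, ∀ p ∈ T, ((η k - l : ℝ) : EReal) < a p := by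
    rw [eventually_all_finset]
    intro p hp
    have h1 : Tendsto (fun k => ((η k - l : ℝ) : EReal)) atTop (𝓝 ((l - l : ℝ) : EReal)) :=
      EReal.tendsto_coe.2 (hlim.sub_const l)
    refine h1.eventually_lt_const ?_
    simpa using ha p (hTΓ p hp)
  obtain ⟨N, hN⟩ := eventually_atTop.1 (hev.and heva)
  refine (summable_nat_add_iff N).1 ?_
  -- Different indices may use different points of `T`. Each `ψ p` is nonincreasing along the
  -- sequence, so the decrease of the sum dominates that of whichever `ψ p` applies, and one
  -- telescoping quantity suffices.
  let Ψ : ℕ → ℝ := fun k => ∑ p ∈ T, ψ p (η (k + N) - l)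
  have hnn : ∀ k, 0 ≤ η k - l := fun k => sub_nonneg.2 (hge k)
  have hmem : ∀ k, N ≤ k → ∀ p ∈ T, deriv (ψ p) (η k - l) * (η k - η (k + 1)) ≤
      ψ p (η k - l) - ψ p (η (k + 1) - l) := by
    intro k hk p hp
    have := deriv_mul_sub_le_of_concaveOn (hψconc p (hTΓ p hp)) (hnn (k + 1))
      (sub_le_sub_right (hanti k.le_succ) l) ((hN k hk).2 p hp)
      (fun h => hψd p (hTΓ p hp) _ h ((hN k hk).2 p hp))
    simpa using this
  have hmono : ∀ k, N ≤ k → ∀ p ∈ T, ψ p (η (k + 1) - l) ≤ ψ p (η k - l) := by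
    intro k hk p hp
    have h1 := hmem k hk p hp
    rcases (hnn k).eq_or_lt with h0 | h0
    · have h2 : η (k + 1) = η k := by
        have := hnn (k + 1)
        have := hanti k.le_succ
        linarith
      rw [h2]
    · have := hψd p (hTΓ p hp) _ h0 ((hN k hk).2 p hp)
      have : 0 ≤ deriv (ψ p) (η k - l) * (η k - η (k + 1)) :=
        mul_nonneg this.le (sub_nonneg.2 (hanti k.le_succ))
      linarith
  have hΨ' : ∀ k, Ψ (k + 1) = ∑ p ∈ T, ψ p (η (k + N + 1) - l) := by
    intro k
    simp only [Ψ, Nat.add_right_comm k 1 N]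
  refine summable_of_sq_le_telescoping (C := M / s) (Ψ := Ψ) (by positivity) (fun k => hd _)
    (fun k => Finset.sum_nonneg fun p hp =>
      hψ0 p (hTΓ p hp) _ (hnn _) ((hN _ (Nat.le_add_left N k)).2 p hp)) ?_ ?_
  · intro k
    rw [hΨ']
    exact Finset.sum_le_sum fun p hp => hmono _ (Nat.le_add_left N k) p hp
  · intro k
    rw [hΨ', Nat.add_right_comm k 1 N]
    simp only [Ψ]
    generalize hj : k + N = j
    have hNj : N ≤ j := by omega
    rw [← Finset.sum_sub_distrib]
    have hsq : d (j + 1) ^ 2 ≤ (η j - η (j + 1)) / s := by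
      rw [le_div_iff₀ hs]
      linarith [hdesc j]
    -- If the limit value is already reached, the values are constant from `j` on and `d (j + 1) =
    -- 0`; the KL inequality is only available above `l`.
    rcases (hnn j).eq_or_lt with h0 | h0
    · have h2 : η (j + 1) = η j := by
        have := hnn (j + 1)
        have := hanti j.le_succ
        linarith
      rw [h2] at hsq ⊢
      simpa using hsq
    · obtain ⟨p, hpT, hpU⟩ : ∃ p ∈ T, ζ j ∈ interior (U p) := by
        simpa using (hN j hNj).1
      have hpΓ := hTΓ p hpT
      have hφp : φ p = l := (hcl p hpΓ).1
      have hja := (hN j hNj).2 p hpT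
      have hD := hψd p hpΓ _ h0 hja
      have hkl := hψKL p hpΓ (ζ j) (interior_subset hpU)
        (by rw [hφp, hη]; exact EReal.coe_lt_coe_iff.2 (by linarith))
        (by
          rw [hφp, hη]
          have : ((η j : ℝ) : EReal) = (l : EReal) + ((η j - l : ℝ) : EReal) := by
            rw [← EReal.coe_add]; congr 1; ring
          rw [this]
          exact EReal.add_lt_add_left_coe hja l)
      have e : (φ (ζ j) - φ p).toReal = η j - l := by
        rw [hφp, hη, ← EReal.coe_sub, EReal.toReal_coe]
      rw [e] at hkl
      have h1 : (1 : ENNReal) ≤ ENNReal.ofReal (deriv (ψ p) (η j - l) * (M * d j)) := by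
        rw [ENNReal.ofReal_mul hD.le]
        exact hkl.trans (by gcongr; exact hsub j)
      rw [ENNReal.one_le_ofReal] at h1
      have h2 := hmem j hNj p hpT
      have h3 : ψ p (η j - l) - ψ p (η (j + 1) - l) ≤
          ∑ q ∈ T, (ψ q (η j - l) - ψ q (η (j + 1) - l)) :=
        Finset.single_le_sum (f := fun q => ψ q (η j - l) - ψ q (η (j + 1) - l))
          (fun q hq => sub_nonneg.2 (hmono j hNj q hq)) hpT
      have h4 : 0 ≤ η j - η (j + 1) := sub_nonneg.2 (hanti j.le_succ)
      calc d (j + 1) ^ 2 ≤ (η j - η (j + 1)) / s := hsq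
        _ ≤ (deriv (ψ p) (η j - l) * (M * d j) * (η j - η (j + 1))) / s := by
          gcongr
          nlinarith
        _ = M / s * (deriv (ψ p) (η j - l) * (η j - η (j + 1))) * d j := by ring
        _ ≤ _ := by
          have := hd j
          gcongr
          exact h2.trans h3

end FracProg

/-! ### Smooth estimates and the subgradients of `H`. -/

namespace FracProg

section Compact

variable {V W : Type*} [NormedAddCommGroup V] [NormedAddCommGroup W]

theorem _root_.LocallyLipschitz.exists_norm_sub_le_of_isCompact {F : V → W}
    (hF : LocallyLipschitz F) {S : Set V} (hS : IsCompact S) :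
    ∃ L : ℝ, 0 < L ∧ ∀ x ∈ S, ∀ y ∈ S, ‖F x - F y‖ ≤ L * ‖x - y‖ := by
  obtain ⟨K, hK⟩ := (hF.locallyLipschitzOn (s := S)).exists_lipschitzOnWith_of_compact hS
  refine ⟨K + 1, by positivity, fun x hx y hy => (hK.norm_sub_le hx hy).trans ?_⟩
  gcongr
  simp

theorem _root_.Continuous.exists_norm_le_of_isCompact {F : V → W} (hF : Continuous F)
    {S : Set V} (hS : IsCompact S) :
    ∃ M : ℝ, 0 < M ∧ ∀ x ∈ S, ‖F x‖ ≤ M := by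
  obtain ⟨M, hM⟩ := hS.exists_bound_of_continuousOn hF.continuousOn
  exact ⟨|M| + 1, by positivity, fun x hx => (hM x hx).trans (by linarith [le_abs_self M])⟩

end Compact

section Smooth

variable {V : Type*} [NormedAddCommGroup V] [InnerProductSpace ℝ V] [CompleteSpace V]

theorem inner_gradient_eq_fderiv (g : V → ℝ) (x v : V) :
    inner ℝ (gradient g x) v = fderiv ℝ g x v := by
  simp [gradient, InnerProductSpace.toDual_symm_apply]

theorem norm_fderiv_sub_fderiv (g : V → ℝ) (x y : V) :
    ‖fderiv ℝ g x - fderiv ℝ g y‖ = ‖gradient g x - gradient g y‖ := by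
  rw [gradient, gradient, ← map_sub, LinearIsometryEquiv.norm_map]

/-- The descent lemma, without the sharp constant. -/
theorem abs_sub_sub_inner_gradient_le {g : V → ℝ} (hg : Differentiable ℝ g) {S : Set V}
    (hS : Convex ℝ S) {L : ℝ} (hL0 : 0 ≤ L)
    (hL : ∀ x ∈ S, ∀ y ∈ S, ‖gradient g x - gradient g y‖ ≤ L * ‖x - y‖) {x y : V}
    (hx : x ∈ S) (hy : y ∈ S) :
    |g y - g x - inner ℝ (gradient g x) (y - x)| ≤ L * ‖y - x‖ ^ 2 := by
  have h := (convex_segment x y).norm_image_sub_le_of_norm_fderiv_le' (𝕜 := ℝ) (f := g)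
    (φ := fderiv ℝ g x) (C := L * ‖y - x‖) (fun z _ => hg z) (fun z hz => ?_)
    (left_mem_segment ℝ x y) (right_mem_segment ℝ x y)
  · rw [inner_gradient_eq_fderiv, ← Real.norm_eq_abs]
    calc _ ≤ _ := h
      _ = _ := by ring
  · rw [norm_fderiv_sub_fderiv]
    refine (hL z (hS.segment_subset hx hy hz) x hx).trans ?_
    gcongr
    obtain ⟨s, t, hs, ht, hst, rfl⟩ := hz
    have e : s • x + t • y - x = t • (y - x) := by
      obtain rfl : s = 1 - t := by linarith
      rw [sub_smul, smul_sub, one_smul]; abel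
    rw [e, norm_smul, Real.norm_of_nonneg ht]
    have : t ≤ 1 := by linarith
    exact mul_le_of_le_one_left (norm_nonneg _) this

theorem contDiff_one_of_continuous_gradient {g : V → ℝ} (hg : Differentiable ℝ g)
    (hc : Continuous (gradient g)) : ContDiff ℝ 1 g := by
  refine contDiff_one_iff_fderiv.2 ⟨hg, ?_⟩
  have : fderiv ℝ g = fun x => InnerProductSpace.toDual ℝ V (gradient g x) := by
    ext x v
    simp [gradient]
  rw [this]
  exact (InnerProductSpace.toDual ℝ V).continuous.comp hc

end Smooth

section AuxH

variable {n : ℕ} {f g h₁ h₂ : E n → ℝ} {C : Set (E n)}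

theorem auxH_of_mem {x z : E n} {c b : ℝ} (hx : x ∈ C) (hb : conjugate h₂ z = b) :
    auxH f g h₁ h₂ C x z c =
      ((2 * c * f x - c ^ 2 * g x + h₁ x + b - inner ℝ x z : ℝ) : EReal) := by
  rw [auxH, scaledPlusIndicator_of_mem hx, hb]
  rfl

/-- In `EReal`, `⊤ + ⊥ = ⊥`; the conjugate is never `⊥`, so the value `⊤` of the indicator survives.
-/
theorem auxH_of_notMem {x z : E n} {c : ℝ} (hx : x ∉ C) : auxH f g h₁ h₂ C x z c = ⊤ := by
  have h := (lt_of_lt_of_le (EReal.bot_lt_coe _) (conjugate_ge h₂ 0 z)).ne'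
  rw [auxH, scaledPlusIndicator_of_notMem hx]
  induction hc : conjugate h₂ z using EReal.rec with
  | bot => exact absurd hc h
  | top => rfl
  | coe b => rfl

theorem le_auxH {x z : E n} {c b : ℝ} (hx : x ∈ C) (hb : (b : EReal) ≤ conjugate h₂ z) :
    ((2 * c * f x - c ^ 2 * g x + h₁ x + b - inner ℝ x z : ℝ) : EReal) ≤
      auxH f g h₁ h₂ C x z c := by
  induction hc : conjugate h₂ z using EReal.rec with
  | bot => rw [hc] at hb; exact absurd (le_bot_iff.1 hb) (EReal.coe_ne_bot _)
  | top =>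
    have : auxH f g h₁ h₂ C x z c = ⊤ := by
      rw [auxH, scaledPlusIndicator_of_mem hx, hc]
      rfl
    rw [this]
    exact le_top
  | coe b' =>
    rw [auxH_of_mem hx hc, EReal.coe_le_coe_iff]
    rw [hc, EReal.coe_le_coe_iff] at hb
    linarith

theorem objective_of_mem {x : E n} (hx : x ∈ Omega g ∩ C) :
    objective f g h₁ h₂ C x = ((f x ^ 2 / g x + h₁ x - h₂ x : ℝ) : EReal) := if_pos hx

theorem mem_of_objective_lt_top {x : E n} (hx : objective f g h₁ h₂ C x < ⊤) :
    x ∈ Omega g ∩ C := by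
  by_contra h
  rw [objective, if_neg h] at hx
  exact lt_irrefl _ hx

/-- The point `(x, z, c)` of `ℝⁿ × ℝⁿ × ℝ`. -/
def mk3 (x z : E n) (c : ℝ) : E3 n := WithLp.toLp 2 (x, WithLp.toLp 2 (z, c))

theorem inner_mk3 (x z : E n) (c : ℝ) (q : E3 n) :
    inner ℝ (mk3 x z c) q = inner ℝ x q.fst + (inner ℝ z q.snd.fst + c * q.snd.snd) := by
  simp only [mk3, WithLp.prod_inner_apply]
  simp [mul_comm]

theorem norm_mk3_le (x z : E n) : ‖mk3 x z 0‖ ≤ ‖x‖ + ‖z‖ := by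
  refine abs_le_of_sq_le_sq' ?_ (by positivity) |>.2
  rw [mk3, WithLp.prod_norm_sq_eq_of_L2, WithLp.prod_norm_sq_eq_of_L2]
  simp only [WithLp.toLp_fst, WithLp.toLp_snd, norm_zero]
  nlinarith [norm_nonneg x, norm_nonneg z]

theorem continuous_mk3 : Continuous fun p : E n × E n × ℝ => mk3 p.1 p.2.1 p.2.2 := by
  unfold mk3
  fun_prop

/-- This is `H` with `f` frozen at the value `a` in the product `2 c f`, and `h₂^*` replaced by its
affine minorant from `u` (up to a constant). The condition `a = c₀ * g x₀` makes the `c`-derivative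
`2 a - 2 c₀ g x₀` vanish. -/
theorem hasFDerivAt_smoothPart (hg : Differentiable ℝ g) (hh₁ : Differentiable ℝ h₁)
    (x₀ z₀ u : E n) (c₀ a : ℝ) (ha : a = c₀ * g x₀) :
    HasFDerivAt (fun p : E3 n => 2 * p.snd.snd * a - p.snd.snd ^ 2 * g p.fst + h₁ p.fst +
        inner ℝ u p.snd.fst - inner ℝ p.fst p.snd.fst)
      (innerSL ℝ (mk3 (-(c₀ ^ 2 • gradient g x₀) + gradient h₁ x₀ - z₀) (u - x₀) 0))
      (mk3 x₀ z₀ c₀) := by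
  have d1 : HasFDerivAt (fun p : E3 n => p.fst) (WithLp.fstL 2 ℝ _ _) (mk3 x₀ z₀ c₀) :=
    (WithLp.fstL 2 ℝ (E n) (WithLp 2 (E n × ℝ))).hasFDerivAt
  have d2 : HasFDerivAt (fun p : E3 n => p.snd) (WithLp.sndL 2 ℝ _ _) (mk3 x₀ z₀ c₀) :=
    (WithLp.sndL 2 ℝ (E n) (WithLp 2 (E n × ℝ))).hasFDerivAt
  have d3 := (WithLp.fstL 2 ℝ (E n) ℝ).hasFDerivAt.comp (mk3 x₀ z₀ c₀) d2
  have d4 := (WithLp.sndL 2 ℝ (E n) ℝ).hasFDerivAt.comp (mk3 x₀ z₀ c₀) d2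
  have dg := (hg x₀).hasFDerivAt.comp (mk3 x₀ z₀ c₀) d1
  have dh := (hh₁ x₀).hasFDerivAt.comp (mk3 x₀ z₀ c₀) d1
  have du := (innerSL ℝ u).hasFDerivAt.comp (mk3 x₀ z₀ c₀) d3
  have H := (((((d4.const_mul 2).mul_const a).sub ((d4.pow 2).mul dg)).add dh).add du).sub
    (d1.inner ℝ d3)
  refine H.congr_fderiv ?_
  ext q
  rw [innerSL_apply_apply, inner_mk3]
  simp only [inner_sub_left, inner_add_left, inner_neg_left, real_inner_smul_left,
    inner_gradient_eq_fderiv]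
  simp [mk3, ha]
  rw [real_inner_comm z₀ q.fst]
  ring

/-- The nonsmooth product is split as `2 c f(x) = 2 c₀ f(x) + 2 (c - c₀) f(x₀) + 2 (c - c₀)(f(x) -
f(x₀))`. The first term is bounded below through `w`, the second is smooth, and the third is `o(‖p -
p₀‖)`, `p₀` being the base point, by continuity of `f`. The affine minorant of `h₂^*` from `u` is
exact at `z₀`. -/
theorem mem_frechetSubdiff_auxH3 (hf : Continuous f) (hg : Differentiable ℝ g)
    (hh₁ : Differentiable ℝ h₁) {x₀ z₀ u w : E n} {c₀ : ℝ} (hx₀ : x₀ ∈ C)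
    (hc₀ : f x₀ = c₀ * g x₀) (hw : HasSubgradientOn (fun y => 2 * c₀ * f y) C w x₀)
    (hz₀ : HasSubgradientOn h₂ Set.univ z₀ u) :
    mk3 (w - c₀ ^ 2 • gradient g x₀ + gradient h₁ x₀ - z₀) (u - x₀) 0 ∈
      frechetSubdiff (auxH3 f g h₁ h₂ C) (mk3 x₀ z₀ c₀) := by
  have hconj := conjugate_eq_of_hasSubgradientOn hz₀
  refine mem_frechetSubdiff_of_eventually_le (auxH_of_mem hx₀ hconj) fun ε hε => ?_
  have hS := (hasFDerivAt_smoothPart hg hh₁ x₀ z₀ u c₀ (f x₀) hc₀).isLittleO.def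
    (half_pos hε)
  have hfc : ∀ᶠ p : E3 n in 𝓝 (mk3 x₀ z₀ c₀), |f p.fst - f x₀| < ε / 4 := by
    have h1 : Continuous fun p : E3 n => |f p.fst - f x₀| := by fun_prop
    refine (h1.tendsto (mk3 x₀ z₀ c₀)).eventually_lt_const ?_
    simpa [mk3] using hε
  filter_upwards [hS, hfc] with p hp1 hp2
  by_cases hpC : p.fst ∈ C
  swap
  · rw [auxH3, auxH_of_notMem hpC]
    exact le_top
  refine le_trans (EReal.coe_le_coe_iff.2 ?_) (le_auxH hpC (conjugate_ge h₂ u p.snd.fst))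
  have hsplit : inner ℝ (mk3 (w - c₀ ^ 2 • gradient g x₀ + gradient h₁ x₀ - z₀) (u - x₀) 0)
      (p - mk3 x₀ z₀ c₀) = inner ℝ w (p.fst - x₀) +
        inner ℝ (mk3 (-(c₀ ^ 2 • gradient g x₀) + gradient h₁ x₀ - z₀) (u - x₀) 0)
          (p - mk3 x₀ z₀ c₀) := by
    simp only [inner_mk3, inner_sub_left, inner_add_left, inner_neg_left]
    simp only [mk3, WithLp.sub_fst, WithLp.toLp_fst]
    ring
  rw [hsplit]
  have hw' := hw p.fst hpC
  rw [innerSL_apply_apply, Real.norm_eq_abs] at hp1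
  have hp1' := (abs_le.1 hp1).1
  have hcn : |p.snd.snd - c₀| ≤ ‖p - mk3 x₀ z₀ c₀‖ := by
    have h1 := WithLp.norm_snd_le _ (p - mk3 x₀ z₀ c₀)
    have h2 := WithLp.norm_snd_le _ (p - mk3 x₀ z₀ c₀).snd
    exact h2.trans h1
  have hprod : |2 * (p.snd.snd - c₀) * (f p.fst - f x₀)| ≤ ε / 2 * ‖p - mk3 x₀ z₀ c₀‖ := by
    rw [abs_mul, abs_mul, abs_two]
    calc 2 * |p.snd.snd - c₀| * |f p.fst - f x₀| ≤ 2 * ‖p - mk3 x₀ z₀ c₀‖ * (ε / 4) := by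
          gcongr
      _ = _ := by ring
  have hprod' := (abs_le.1 hprod).1
  generalize inner ℝ (mk3 (-(c₀ ^ 2 • gradient g x₀) + gradient h₁ x₀ - z₀) (u - x₀) 0)
          (p - mk3 x₀ z₀ c₀) = A at *
  generalize ‖p - mk3 x₀ z₀ c₀‖ = B at *
  simp only [mk3, WithLp.toLp_fst, WithLp.toLp_snd] at hp1' ⊢
  linarith

end AuxH

end FracProg

/-! ### Uniform estimates for one proximal step. -/

namespace FracProg

variable {n : ℕ} {f g h₁ h₂ : E n → ℝ} {C X : Set (E n)}

/-- Bounds and Lipschitz estimates, with one constant `K`, for the data of the problem on a ball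
that contains the unit neighbourhood of `X`, and a positive lower bound `η` of `g` on `X`. -/
structure UniformBounds (f g h₁ h₂ : E n → ℝ) (X : Set (E n)) (R K η : ℝ) : Prop where
  K_pos : 0 < K
  η_pos : 0 < η
  subset : X ⊆ Metric.closedBall 0 R
  le_g : ∀ x ∈ X, η ≤ g x
  f_le : ∀ x ∈ Metric.closedBall (0 : E n) (R + 1), f x ≤ K
  f_lip : ∀ x ∈ Metric.closedBall (0 : E n) (R + 1), ∀ y ∈ Metric.closedBall (0 : E n) (R + 1),
    |f x - f y| ≤ K * ‖x - y‖
  g_lip : ∀ x ∈ Metric.closedBall (0 : E n) (R + 1), ∀ y ∈ Metric.closedBall (0 : E n) (R + 1),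
    |g x - g y| ≤ K * ‖x - y‖
  h₂_lip : ∀ x ∈ Metric.closedBall (0 : E n) (R + 1), ∀ y ∈ Metric.closedBall (0 : E n) (R + 1),
    |h₂ x - h₂ y| ≤ K * ‖x - y‖
  grad_g_le : ∀ x ∈ Metric.closedBall (0 : E n) (R + 1), ‖gradient g x‖ ≤ K
  grad_h₁_le : ∀ x ∈ Metric.closedBall (0 : E n) (R + 1), ‖gradient h₁ x‖ ≤ K
  grad_g_lip : ∀ x ∈ Metric.closedBall (0 : E n) (R + 1),
    ∀ y ∈ Metric.closedBall (0 : E n) (R + 1), ‖gradient g x - gradient g y‖ ≤ K * ‖x - y‖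
  grad_h₁_lip : ∀ x ∈ Metric.closedBall (0 : E n) (R + 1),
    ∀ y ∈ Metric.closedBall (0 : E n) (R + 1), ‖gradient h₁ x - gradient h₁ y‖ ≤ K * ‖x - y‖

theorem exists_uniformBounds (hf : ConvexOn ℝ Set.univ f) (hg_nonneg : ∀ x, 0 ≤ g x)
    (hg : Differentiable ℝ g) (hg_lip : LocallyLipschitz (gradient g))
    (hh₁_lip : LocallyLipschitz (gradient h₁)) (hh₂ : ConvexOn ℝ Set.univ h₂)
    (hX : IsCompact X) (hXg : X ⊆ Omega g) : ∃ R K η, UniformBounds f g h₁ h₂ X R K η := by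
  obtain ⟨R, hR⟩ := hX.isBounded.subset_closedBall 0
  have hS : IsCompact (Metric.closedBall (0 : E n) (R + 1)) := isCompact_closedBall _ _
  obtain ⟨K₁, p₁, b₁⟩ := hf.locallyLipschitz.continuous.exists_norm_le_of_isCompact hS
  obtain ⟨K₂, p₂, b₂⟩ := hf.locallyLipschitz.exists_norm_sub_le_of_isCompact hS
  obtain ⟨K₃, p₃, b₃⟩ := (contDiff_one_of_continuous_gradient hg
    hg_lip.continuous).locallyLipschitz.exists_norm_sub_le_of_isCompact hS
  obtain ⟨K₄, p₄, b₄⟩ := hh₂.locallyLipschitz.exists_norm_sub_le_of_isCompact hS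
  obtain ⟨K₅, p₅, b₅⟩ := hg_lip.continuous.exists_norm_le_of_isCompact hS
  obtain ⟨K₆, p₆, b₆⟩ := hh₁_lip.continuous.exists_norm_le_of_isCompact hS
  obtain ⟨K₇, p₇, b₇⟩ := hg_lip.exists_norm_sub_le_of_isCompact hS
  obtain ⟨K₈, p₈, b₈⟩ := hh₁_lip.exists_norm_sub_le_of_isCompact hS
  obtain ⟨η, hη, hgη⟩ : ∃ η : ℝ, 0 < η ∧ ∀ x ∈ X, η ≤ g x := by
    rcases X.eq_empty_or_nonempty with rfl | hne
    · exact ⟨1, one_pos, by simp⟩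
    · obtain ⟨x, hx, hmin⟩ := hX.exists_isMinOn hne hg.continuous.continuousOn
      exact ⟨g x, (hg_nonneg x).lt_of_ne' (hXg hx), fun y hy => hmin hy⟩
  have lip : ∀ {a b t : ℝ}, a ≤ b → 0 ≤ t → a * t ≤ b * t :=
    fun h ht => mul_le_mul_of_nonneg_right h ht
  refine ⟨R, K₁ + K₂ + K₃ + K₄ + K₅ + K₆ + K₇ + K₈, η,
    { K_pos := by positivity
      η_pos := hη
      subset := hR
      le_g := hgη
      f_le := fun x hx => ((le_abs_self _).trans (b₁ x hx)).trans (by linarith)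
      f_lip := fun x hx y hy => (b₂ x hx y hy).trans (lip (by linarith) (norm_nonneg _))
      g_lip := fun x hx y hy => (b₃ x hx y hy).trans (lip (by linarith) (norm_nonneg _))
      h₂_lip := fun x hx y hy => (b₄ x hx y hy).trans (lip (by linarith) (norm_nonneg _))
      grad_g_le := fun x hx => (b₅ x hx).trans (by linarith)
      grad_h₁_le := fun x hx => (b₆ x hx).trans (by linarith)
      grad_g_lip := fun x hx y hy => (b₇ x hx y hy).trans (lip (by linarith) (norm_nonneg _))
      grad_h₁_lip := fun x hx y hy => (b₈ x hx y hy).trans (lip (by linarith) (norm_nonneg _)) }⟩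

namespace UniformBounds

variable {R K η : ℝ} (B : UniformBounds f g h₁ h₂ X R K η)
include B

theorem mem_closedBall {x y : E n} (hx : x ∈ X) (hy : ‖y - x‖ ≤ 1) :
    y ∈ Metric.closedBall (0 : E n) (R + 1) := by
  have h1 := B.subset hx
  rw [mem_closedBall_zero_iff] at h1 ⊢
  calc ‖y‖ = ‖x + (y - x)‖ := by congr 1; abel
    _ ≤ ‖x‖ + ‖y - x‖ := norm_add_le _ _
    _ ≤ R + 1 := add_le_add h1 hy

theorem mem_closedBall_self {x : E n} (hx : x ∈ X) : x ∈ Metric.closedBall (0 : E n) (R + 1) :=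
  B.mem_closedBall hx (by simp)

theorem norm_le_of_hasSubgradientOn {h : E n → ℝ}
    (hh : ∀ x ∈ Metric.closedBall (0 : E n) (R + 1), ∀ y ∈ Metric.closedBall (0 : E n) (R + 1),
      |h x - h y| ≤ K * ‖x - y‖) {x v : E n} (hx : x ∈ X)
    (hv : HasSubgradientOn h Set.univ v x) : ‖v‖ ≤ K :=
  hv.norm_le one_pos B.K_pos.le fun y hy =>
    (le_abs_self _).trans (hh y (B.mem_closedBall hx hy) x (B.mem_closedBall_self hx))

theorem g_pos {x : E n} (hx : x ∈ X) : 0 < g x := B.η_pos.trans_le (B.le_g x hx)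

theorem ratio_nonneg (hf : ∀ x, 0 ≤ f x) {x : E n} (hx : x ∈ X) : 0 ≤ f x / g x :=
  div_nonneg (hf x) (B.g_pos hx).le

theorem ratio_le {x : E n} (hx : x ∈ X) : f x / g x ≤ K / η :=
  div_le_div₀ B.K_pos.le (B.f_le x (B.mem_closedBall_self hx)) B.η_pos (B.le_g x hx)

/-- With the ratio frozen at `x`, the expression vanishes at `y = x`. Its square measures the cost
of updating the ratio, which is therefore quadratic in the step. -/
theorem abs_sub_ratio_mul_le (hf : ∀ x, 0 ≤ f x) {x y : E n} (hx : x ∈ X)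
    (hy : y ∈ Metric.closedBall (0 : E n) (R + 1)) :
    |f y - f x / g x * g y| ≤ (1 + K / η) * K * ‖y - x‖ := by
  have e : f y - f x / g x * g y = (f y - f x) - f x / g x * (g y - g x) := by
    have := (B.g_pos hx).ne'
    field_simp
    ring
  have h1 := B.f_lip y hy x (B.mem_closedBall_self hx)
  have h2 := B.g_lip y hy x (B.mem_closedBall_self hx)
  have h3 := B.ratio_nonneg hf hx
  have hK := B.K_pos
  have hη := B.η_pos
  rw [e]
  calc _ ≤ |f y - f x| + |f x / g x * (g y - g x)| := abs_sub _ _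
    _ = |f y - f x| + f x / g x * |g y - g x| := by rw [abs_mul, abs_of_nonneg h3]
    _ ≤ K * ‖y - x‖ + K / η * (K * ‖y - x‖) :=
      add_le_add h1 (mul_le_mul (B.ratio_le hx) h2 (abs_nonneg _) (by positivity))
    _ = _ := by ring

theorem abs_ratio_sub_ratio_le (hf : ∀ x, 0 ≤ f x) {x y : E n} (hx : x ∈ X) (hy : y ∈ X) :
    |f y / g y - f x / g x| ≤ (1 + K / η) * K / η * ‖y - x‖ := by
  have hgy := B.g_pos hy
  have e : f y / g y - f x / g x = (f y - f x / g x * g y) / g y := by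
    field_simp
  have hK := B.K_pos
  have hη := B.η_pos
  rw [e, abs_div, abs_of_pos hgy]
  calc _ ≤ (1 + K / η) * K * ‖y - x‖ / η :=
        div_le_div₀ (by positivity) (B.abs_sub_ratio_mul_le hf hx (B.mem_closedBall_self hy)) hη
          (B.le_g y hy)
    _ = _ := by ring

/-- The gradient of the smooth part of the model at a point of `X` is bounded. -/
theorem norm_direction_le (hf : ∀ x, 0 ≤ f x) {x z : E n} (hx : x ∈ X)
    (hz : HasSubgradientOn h₂ Set.univ z x) :
    ‖gradient h₁ x - (f x / g x) ^ 2 • gradient g x - z‖ ≤ (2 + (K / η) ^ 2) * K := by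
  have hS := B.mem_closedBall_self hx
  have h1 := B.grad_h₁_le x hS
  have h2 := B.grad_g_le x hS
  have h3 := B.norm_le_of_hasSubgradientOn B.h₂_lip hx hz
  have h4 : ‖(f x / g x) ^ 2 • gradient g x‖ ≤ (K / η) ^ 2 * K := by
    rw [norm_smul, norm_pow, Real.norm_of_nonneg (B.ratio_nonneg hf hx)]
    exact mul_le_mul (pow_le_pow_left₀ (B.ratio_nonneg hf hx) (B.ratio_le hx) 2) h2
      (norm_nonneg _) (by positivity)
  calc _ ≤ ‖gradient h₁ x‖ + ‖(f x / g x) ^ 2 • gradient g x‖ + ‖z‖ :=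
        (norm_sub_le _ _).trans (add_le_add_left (norm_sub_le _ _) _)
    _ ≤ K + (K / η) ^ 2 * K + K := by gcongr
    _ = _ := by ring

/-- The proximal step with stepsize `α` has length `O(α)`. -/
theorem norm_step_le (hf : ∀ x, 0 ≤ f x) (hf_convex : ConvexOn ℝ Set.univ f) {x d y : E n}
    {D α : ℝ} (hα : 0 < α) (hx : x ∈ X) (hd : ‖d‖ ≤ D)
    (hprox : 2 * (f x / g x) * (f y - f x) + inner ℝ d (y - x) ≤ -(‖y - x‖ ^ 2 / (2 * α))) :
    ‖y - x‖ ≤ α * (2 * (2 * (K / η) * K + D)) := by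
  -- `y` is not yet known to lie in the ball where `f` is `K`-Lipschitz, so `f y - f x` is bounded
  -- below by a subgradient at `x` instead.
  obtain ⟨v, hv⟩ := exists_hasSubgradientOn_univ hf_convex hf_convex.locallyLipschitz.continuous x
  have hvK := B.norm_le_of_hasSubgradientOn B.f_lip hx hv
  have h1 := hv y (Set.mem_univ y)
  have hr := B.ratio_nonneg hf hx
  have hrK := B.ratio_le hx
  have hK := B.K_pos
  have hη := B.η_pos
  have h2 : -(K * ‖y - x‖) ≤ inner ℝ v (y - x) :=
    (abs_le.1 ((abs_real_inner_le_norm v (y - x)).trans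
      (mul_le_mul_of_nonneg_right hvK (norm_nonneg _)))).1
  have h3 : -(D * ‖y - x‖) ≤ inner ℝ d (y - x) :=
    (abs_le.1 ((abs_real_inner_le_norm d (y - x)).trans
      (mul_le_mul_of_nonneg_right hd (norm_nonneg _)))).1
  have h4 : 2 * (f x / g x) * (-(K * ‖y - x‖)) ≤ 2 * (f x / g x) * (f y - f x) :=
    mul_le_mul_of_nonneg_left (by linarith) (by positivity)
  have h5 : f x / g x * (K * ‖y - x‖) ≤ K / η * (K * ‖y - x‖) :=
    mul_le_mul_of_nonneg_right hrK (by positivity)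
  have h6 : ‖y - x‖ ^ 2 / (2 * α) ≤ (2 * (K / η) * K + D) * ‖y - x‖ := by nlinarith
  rw [div_le_iff₀ (by positivity)] at h6
  rcases (norm_nonneg (y - x)).eq_or_lt with h0 | h0
  · rw [← h0]
    have : 0 ≤ D := (norm_nonneg d).trans hd
    positivity
  · refine le_of_mul_le_mul_right ?_ h0
    nlinarith

end UniformBounds

/-- The inequality satisfied by a proximal step, compared with the current point. -/
theorem prox_step_le {x d y : E n} {α c : ℝ} (hα : 0 < α) (hx : x ∈ C) (hy : y ∈ C)
    (h : y ∈ prox (scaledPlusIndicator (2 * α * c) f C) (x - α • d)) :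
    2 * c * (f y - f x) + inner ℝ d (y - x) ≤ -(‖y - x‖ ^ 2 / (2 * α)) := by
  have h1 := le_of_mem_prox_scaledPlusIndicator h hy hx
  have e1 : x - α • d - y = -((y - x) + α • d) := by abel
  have e2 : x - α • d - x = -(α • d) := by abel
  rw [e1, e2, norm_neg, norm_neg, norm_add_sq_real, inner_smul_right, real_inner_comm] at h1
  have h2 : α * (2 * c * (f y - f x) + inner ℝ d (y - x)) ≤ α * (-(‖y - x‖ ^ 2 / (2 * α))) := by
    have : α * (-(‖y - x‖ ^ 2 / (2 * α))) = -(1 / 2 * ‖y - x‖ ^ 2) := by field_simp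
    rw [this]
    nlinarith
  exact le_of_mul_le_mul_left h2 hα

/-- The proximal decrease `‖y - x‖² / (2α)` must pay for four quadratic terms, the summands in
`hαρ`: linearising `g`, linearising `h₁`, updating the ratio, and the `σ/2` of the test. The bound
`hρη` keeps `g y ≥ η / 2`. -/
theorem UniformBounds.accepts_of_small {R K η : ℝ} (B : UniformBounds f g h₁ h₂ X R K η)
    (hf : ∀ x, 0 ≤ f x) (hg : Differentiable ℝ g) (hh₁ : Differentiable ℝ h₁)
    {σ : ℝ} {x z y : E n} {α ρ : ℝ} (hx : x ∈ X) (hxC : x ∈ C) (hyC : y ∈ C)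
    (hz : HasSubgradientOn h₂ Set.univ z x)
    (hprox : 2 * (f x / g x) * (f y - f x) +
      inner ℝ (gradient h₁ x - (f x / g x) ^ 2 • gradient g x - z) (y - x) ≤
        -(‖y - x‖ ^ 2 / (2 * α)))
    (hρ : ‖y - x‖ ≤ ρ) (hρ1 : ρ ≤ 1) (hρη : K * ρ ≤ η / 2)
    (hαρ : (K / η) ^ 2 * K + K + ((1 + K / η) * K) ^ 2 / (η / 2) + σ / 2 ≤ 1 / (2 * α)) :
    Accepts f g h₁ h₂ C σ x z y := by
  have hxS := B.mem_closedBall_self hx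
  have hyS := B.mem_closedBall hx (hρ.trans hρ1)
  have hK := B.K_pos
  have hη := B.η_pos
  have hgx := B.g_pos hx
  have hgy : η / 2 ≤ g y := by
    have h1 := (abs_le.1 (B.g_lip y hyS x hxS)).1
    have h2 : K * ‖y - x‖ ≤ K * ρ := mul_le_mul_of_nonneg_left hρ hK.le
    have h3 := B.le_g x hx
    linarith
  have hgy0 : 0 < g y := by linarith
  refine ⟨hgy0.ne', ?_⟩
  rw [objective_of_mem ⟨hgx.ne', hxC⟩, auxH_of_mem hyC (conjugate_eq_of_hasSubgradientOn hz),
    ← EReal.coe_add, EReal.coe_le_coe_iff]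
  have dg := (abs_le.1 (abs_sub_sub_inner_gradient_le hg (convex_closedBall (0 : E n) (R + 1))
    hK.le B.grad_g_lip hxS hyS)).1
  have dh := (abs_le.1 (abs_sub_sub_inner_gradient_le hh₁ (convex_closedBall (0 : E n) (R + 1))
    hK.le B.grad_h₁_lip hxS hyS)).2
  have hr := B.ratio_nonneg hf hx
  have hrK := B.ratio_le hx
  have hq := B.abs_sub_ratio_mul_le hf hx hyS
  set c := f x / g x with hc
  have hfx : f x = c * g x := by rw [hc]; field_simp
  -- Completing the square in `c`: the optimal multiplier at `y` gains `(f y - c g y)² / g y` over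
  -- the old one.
  have e1 : 2 * (f y / g y) * f y - (f y / g y) ^ 2 * g y =
      2 * c * f y - c ^ 2 * g y + (f y - c * g y) ^ 2 / g y := by
    field_simp
    ring
  have e2 : f x ^ 2 / g x = 2 * c * f x - c ^ 2 * g x := by
    rw [hfx]
    field_simp
    ring
  have e3 : (f y - c * g y) ^ 2 / g y ≤ ((1 + K / η) * K) ^ 2 / (η / 2) * ‖y - x‖ ^ 2 := by
    calc _ ≤ ((1 + K / η) * K * ‖y - x‖) ^ 2 / (η / 2) := by
          refine div_le_div₀ (by positivity) ?_ (by positivity) hgy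
          rw [← sq_abs (f y - c * g y)]
          gcongr
      _ = _ := by ring
  have e4 : c ^ 2 * (K * ‖y - x‖ ^ 2) ≤ (K / η) ^ 2 * (K * ‖y - x‖ ^ 2) := by gcongr
  have e5 : -(c ^ 2 * (g y - g x)) ≤
      -(c ^ 2 * inner ℝ (gradient g x) (y - x)) + c ^ 2 * (K * ‖y - x‖ ^ 2) := by
    nlinarith [mul_le_mul_of_nonneg_left dg (sq_nonneg c)]
  have e6 := mul_le_mul_of_nonneg_right hαρ (sq_nonneg ‖y - x‖)
  have e7 : 1 / (2 * α) * ‖y - x‖ ^ 2 = ‖y - x‖ ^ 2 / (2 * α) := by ring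
  rw [e7] at e6
  rw [inner_sub_left, inner_sub_left, real_inner_smul_left] at hprox
  have e8 : inner ℝ z (y - x) = inner ℝ y z - inner ℝ x z := by
    rw [inner_sub_right, real_inner_comm, real_inner_comm x z]
  rw [e8] at hprox
  rw [e1, e2]
  linarith

/-- The first-order condition for a proximal step, divided by the stepsize. -/
theorem hasSubgradientOn_of_mem_prox (hf : ConvexOn ℝ Set.univ f) (hC : Convex ℝ C) {x d y : E n}
    {α c : ℝ} (hα : 0 < α) (hc : 0 ≤ c) (hy : y ∈ C)
    (h : y ∈ prox (scaledPlusIndicator (2 * α * c) f C) (x - α • d)) :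
    HasSubgradientOn (fun w => 2 * c * f w) C (-(α⁻¹ • (y - x)) - d) y := by
  have h1 := hasSubgradientOn_of_forall_le
    (hf.smul (show 0 ≤ 2 * α * c by positivity)) hC hy
    (fun w hw => le_of_mem_prox_scaledPlusIndicator h hy hw)
  intro w hw
  have h2 := h1 w hw
  simp only [smul_eq_mul] at h2
  have e : x - α • d - y = α • (-(α⁻¹ • (y - x)) - d) := by
    rw [smul_sub, smul_neg, smul_inv_smul₀ hα.ne']
    abel
  rw [e, real_inner_smul_left] at h2
  refine le_of_mul_le_mul_left (a := α) ?_ hα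
  linarith

/-- The relative error estimate. -/
theorem UniformBounds.exists_subgradient_norm_le {R K η : ℝ}
    (B : UniformBounds f g h₁ h₂ X R K η) (hf : ∀ x, 0 ≤ f x) (hf_convex : ConvexOn ℝ Set.univ f)
    (hC : Convex ℝ C) {x y z : E n} {α a : ℝ} (ha : 0 < a) (hα : a ≤ α) (hx : x ∈ X) (hy : y ∈ X)
    (hyC : y ∈ C)
    (h : HasSubgradientOn (fun w => 2 * (f x / g x) * f w) C
      (-(α⁻¹ • (y - x)) - (gradient h₁ x - (f x / g x) ^ 2 • gradient g x - z)) y) :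
    ∃ w, HasSubgradientOn (fun u => 2 * (f y / g y) * f u) C w y ∧
      ‖w - (f y / g y) ^ 2 • gradient g y + gradient h₁ y - z‖ ≤
        (a⁻¹ + K + (K / η) ^ 2 * K + (2 + 2 * (K / η)) * ((1 + K / η) * K / η) * K) *
          ‖y - x‖ := by
  have hrx := B.ratio_nonneg hf hx
  have hry := B.ratio_nonneg hf hy
  have hrxK := B.ratio_le hx
  have hryK := B.ratio_le hy
  have hK := B.K_pos
  have hη := B.η_pos
  have hcc := B.abs_ratio_sub_ratio_le hf hx hy
  have hxS := B.mem_closedBall_self hx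
  have hyS := B.mem_closedBall_self hy
  obtain ⟨v, hv, hN⟩ := h.exists_smul_add_normal (by positivity) hf_convex
    hf_convex.locallyLipschitz.continuous hC hyC
  have hvK := B.norm_le_of_hasSubgradientOn B.f_lip hy hv
  set c := f x / g x
  set c' := f y / g y
  set L := (1 + K / η) * K / η
  set p := -(α⁻¹ • (y - x)) - (gradient h₁ x - c ^ 2 • gradient g x - z) with hp
  -- The proximal step gives a subgradient `p` for the old coefficient `2 c`. Keeping its normal
  -- part `p - 2 c v` and replacing `2 c v` by `2 c' v` yields one for the new coefficient.
  refine ⟨p + (2 * (c' - c)) • v, fun u hu => ?_, ?_⟩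
  · have h1 := hv u (Set.mem_univ u)
    have h2 := hN u hu
    have h3 : 2 * c' * (f y + inner ℝ v (u - y)) ≤ 2 * c' * f u :=
      mul_le_mul_of_nonneg_left h1 (by positivity)
    have e : p + (2 * (c' - c)) • v = (p - (2 * c) • v) + (2 * c') • v := by
      rw [mul_sub, sub_smul]; abel
    rw [e, inner_add_left, real_inner_smul_left]
    linarith
  · have e : p + (2 * (c' - c)) • v - c' ^ 2 • gradient g y + gradient h₁ y - z =
        -(α⁻¹ • (y - x)) + (gradient h₁ y - gradient h₁ x) -
          c' ^ 2 • (gradient g y - gradient g x) +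
          (2 * (c' - c)) • v - ((c' + c) * (c' - c)) • gradient g x := by
      rw [hp]
      module
    have n1 : ‖-(α⁻¹ • (y - x))‖ ≤ a⁻¹ * ‖y - x‖ := by
      rw [norm_neg, norm_smul, Real.norm_of_nonneg (inv_nonneg.2 (ha.le.trans hα))]
      gcongr
    have n2 := B.grad_h₁_lip y hyS x hxS
    have n3 : ‖c' ^ 2 • (gradient g y - gradient g x)‖ ≤ (K / η) ^ 2 * (K * ‖y - x‖) := by
      rw [norm_smul, Real.norm_of_nonneg (sq_nonneg c')]
      gcongr
      exact B.grad_g_lip y hyS x hxS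
    have n4 : ‖(2 * (c' - c)) • v‖ ≤ 2 * (L * ‖y - x‖) * K := by
      rw [norm_smul, Real.norm_eq_abs, abs_mul, abs_two]
      gcongr
    have n5 : ‖((c' + c) * (c' - c)) • gradient g x‖ ≤
        (K / η + K / η) * (L * ‖y - x‖) * K := by
      rw [norm_smul, Real.norm_eq_abs, abs_mul, abs_of_nonneg (add_nonneg hry hrx)]
      gcongr
      exact B.grad_g_le x hxS
    rw [e]
    calc _ ≤ ‖-(α⁻¹ • (y - x))‖ + ‖gradient h₁ y - gradient h₁ x‖ +
          ‖c' ^ 2 • (gradient g y - gradient g x)‖ + ‖(2 * (c' - c)) • v‖ +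
          ‖((c' + c) * (c' - c)) • gradient g x‖ := by
          refine (norm_sub_le _ _).trans (add_le_add_left ?_ _)
          refine (norm_add_le _ _).trans (add_le_add_left ?_ _)
          refine (norm_sub_le _ _).trans (add_le_add_left ?_ _)
          exact norm_add_le _ _
      _ ≤ a⁻¹ * ‖y - x‖ + K * ‖y - x‖ + (K / η) ^ 2 * (K * ‖y - x‖) + 2 * (L * ‖y - x‖) * K +
          (K / η + K / η) * (L * ‖y - x‖) * K := by gcongr
      _ = _ := by ring

end FracProg

/-! ### Convergence from sufficient decrease and relative error. -/

namespace FracProg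

variable {n : ℕ} {f g h₁ h₂ : E n → ℝ} {C X : Set (E n)}

/-- The objective as a real number; meaningful on `Ω ∩ C`. -/
noncomputable def realObjective (f g h₁ h₂ : E n → ℝ) (x : E n) : ℝ := f x ^ 2 / g x + h₁ x - h₂ x

/-- The value of the auxiliary function at `(y, z, f y / g y)`, for `z` a subgradient of `h₂`
at `x`. -/
noncomputable def modelValue (f g h₁ h₂ : E n → ℝ) (x y z : E n) : ℝ :=
  f y ^ 2 / g y + h₁ y + (inner ℝ x z - h₂ x) - inner ℝ y z

theorem auxH_eq_modelValue {x y z : E n} (hg : g y ≠ 0) (hy : y ∈ C)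
    (hz : HasSubgradientOn h₂ Set.univ z x) :
    auxH f g h₁ h₂ C y z (f y / g y) = (modelValue f g h₁ h₂ x y z : ℝ) := by
  rw [auxH_of_mem hy (conjugate_eq_of_hasSubgradientOn hz), modelValue]
  congr 3
  have : 2 * (f y / g y) * f y - (f y / g y) ^ 2 * g y = f y ^ 2 / g y := by
    field_simp
    ring
  rw [this]

theorem realObjective_le_modelValue {x y z : E n} (hz : HasSubgradientOn h₂ Set.univ z x) :
    realObjective f g h₁ h₂ y ≤ modelValue f g h₁ h₂ x y z := by
  have h := hz y (Set.mem_univ y)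
  rw [inner_sub_right, real_inner_comm y z, real_inner_comm x z] at h
  rw [realObjective, modelValue]
  linarith

/-- The properties of the iterates on which the convergence proof rests: sufficient decrease and
a relative error bound, inside a set `X`. -/
structure DescentSequence (f g h₁ h₂ : E n → ℝ) (C X : Set (E n)) (σ M : ℝ)
    (x z w : ℕ → E n) : Prop where
  mem : ∀ k, x k ∈ X
  sub_z : ∀ k, HasSubgradientOn h₂ Set.univ (z k) (x k)
  sub_w : ∀ k, HasSubgradientOn (fun y => 2 * (f (x (k + 1)) / g (x (k + 1))) * f y) C (w k)
    (x (k + 1))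
  error : ∀ k, ‖w k - (f (x (k + 1)) / g (x (k + 1))) ^ 2 • gradient g (x (k + 1)) +
    gradient h₁ (x (k + 1)) - z k‖ ≤ M * ‖x (k + 1) - x k‖
  descent : ∀ k, modelValue f g h₁ h₂ (x k) (x (k + 1)) (z k) +
    σ / 2 * ‖x (k + 1) - x k‖ ^ 2 ≤ realObjective f g h₁ h₂ (x k)

theorem continuousAt_modelValue (hf : Continuous f) (hg : Continuous g) (hh₁ : Continuous h₁)
    (hh₂ : Continuous h₂) {x y z : E n} (hy : g y ≠ 0) :
    ContinuousAt (fun p : E n × E n × E n => modelValue f g h₁ h₂ p.1 p.2.1 p.2.2) (x, y, z) := by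
  unfold modelValue
  have : ContinuousAt (fun p : E n × E n × E n => f p.2.1 ^ 2 / g p.2.1) (x, y, z) :=
    ContinuousAt.div (by fun_prop) (by fun_prop) hy
  fun_prop

namespace DescentSequence

variable {σ M : ℝ} {x z w : ℕ → E n} (S : DescentSequence f g h₁ h₂ C X σ M x z w)
include S

theorem exists_tendsto_modelValue (hf : Continuous f) (hg : Continuous g) (hh₁ : Continuous h₁)
    (hh₂ : Continuous h₂) (hσ : 0 < σ) (hX : IsCompact X) (hXg : X ⊆ Omega g) :
    ∃ l, Tendsto (fun k => modelValue f g h₁ h₂ (x k) (x (k + 1)) (z k)) atTop (𝓝 l) := by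
  have hanti : Antitone fun k => modelValue f g h₁ h₂ (x k) (x (k + 1)) (z k) :=
    antitone_nat_of_succ_le fun k => by
      have h1 := S.descent (k + 1)
      have h2 := realObjective_le_modelValue (f := f) (g := g) (h₁ := h₁) (y := x (k + 1))
        (S.sub_z k)
      have : 0 ≤ σ / 2 * ‖x (k + 1 + 1) - x (k + 1)‖ ^ 2 := by positivity
      linarith
  have hc : ContinuousOn (realObjective f g h₁ h₂) X := by
    intro y hy
    have : ContinuousAt (fun y => f y ^ 2 / g y) y :=
      ContinuousAt.div (by fun_prop) (by fun_prop) (hXg hy)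
    unfold realObjective
    exact ContinuousAt.continuousWithinAt (by fun_prop)
  obtain ⟨b, hb⟩ := (hX.image_of_continuousOn hc).bddBelow
  refine ⟨_, tendsto_atTop_ciInf hanti ⟨b, ?_⟩⟩
  rintro _ ⟨k, rfl⟩
  exact (hb ⟨x (k + 1), S.mem (k + 1), rfl⟩).trans (realObjective_le_modelValue (S.sub_z k))

/-- The value `F(x_{k+1})` separates consecutive model values: the descent inequality bounds it from
below, Fenchel-Young from above. -/
theorem modelValue_succ_le (k : ℕ) :
    modelValue f g h₁ h₂ (x (k + 1)) (x (k + 1 + 1)) (z (k + 1)) +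
      σ / 2 * ‖x (k + 1 + 1) - x (k + 1)‖ ^ 2 ≤
    modelValue f g h₁ h₂ (x k) (x (k + 1)) (z k) :=
  (S.descent (k + 1)).trans (realObjective_le_modelValue (S.sub_z k))

theorem tendsto_norm_sub (hσ : 0 < σ) {l : ℝ}
    (hl : Tendsto (fun k => modelValue f g h₁ h₂ (x k) (x (k + 1)) (z k)) atTop (𝓝 l)) :
    Tendsto (fun k => ‖x (k + 1) - x k‖) atTop (𝓝 0) := by
  -- The drop from model value `k` to `k + 1` controls the step with index `k + 1`.
  rw [← tendsto_add_atTop_iff_nat 1]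
  have h1 := (hl.sub (hl.comp (tendsto_add_atTop_nat 1))).const_mul (2 / σ)
  simp only [sub_self, mul_zero] at h1
  have h2 : Tendsto (fun k => ‖x (k + 1 + 1) - x (k + 1)‖ ^ 2) atTop (𝓝 0) := by
    refine squeeze_zero (fun k => by positivity) (fun k => ?_) h1
    have := S.modelValue_succ_le k
    simp only [Function.comp_apply]
    rw [div_mul_eq_mul_div, le_div_iff₀ hσ]
    linarith
  have h3 := h2.sqrt
  simpa [Real.sqrt_sq (norm_nonneg _)] using h3

/-- Data attached to a cluster point of the sequence `(x (k+1), z k, f (x (k+1)) / g (x (k+1)))`. -/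
theorem limit_of_tendsto (hf : Continuous f) (hg : Continuous g)
    (hh₂ : Continuous h₂) (hX : IsCompact X) (hXg : X ⊆ Omega g)
    (hd : Tendsto (fun k => ‖x (k + 1) - x k‖) atTop (𝓝 0)) {φ : ℕ → ℕ} (hφ : StrictMono φ)
    {p : E3 n} (hp : Tendsto (fun k => mk3 (x (φ k + 1)) (z (φ k))
      (f (x (φ k + 1)) / g (x (φ k + 1)))) atTop (𝓝 p)) :
    p.fst ∈ X ∧ p = mk3 p.fst p.snd.fst (f p.fst / g p.fst) ∧
    HasSubgradientOn h₂ Set.univ p.snd.fst p.fst ∧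
    Tendsto (fun k => x (φ k + 1)) atTop (𝓝 p.fst) ∧
    Tendsto (fun k => x (φ k)) atTop (𝓝 p.fst) ∧
    Tendsto (fun k => z (φ k)) atTop (𝓝 p.snd.fst) := by
  have c1 : Continuous fun q : E3 n => q.fst := by fun_prop
  have c2 : Continuous fun q : E3 n => q.snd.fst := by fun_prop
  have c3 : Continuous fun q : E3 n => q.snd.snd := by fun_prop
  have t1 : Tendsto (fun k => x (φ k + 1)) atTop (𝓝 p.fst) := (c1.tendsto p).comp hp
  have t2 : Tendsto (fun k => z (φ k)) atTop (𝓝 p.snd.fst) := (c2.tendsto p).comp hp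
  have t3 : Tendsto (fun k => f (x (φ k + 1)) / g (x (φ k + 1))) atTop (𝓝 p.snd.snd) :=
    (c3.tendsto p).comp hp
  have hmem : p.fst ∈ X := hX.isClosed.mem_of_tendsto t1 (Eventually.of_forall fun k => S.mem _)
  have t4 : Tendsto (fun k => x (φ k)) atTop (𝓝 p.fst) := by
    have := t1.sub (tendsto_zero_iff_norm_tendsto_zero.2 (hd.comp hφ.tendsto_atTop))
    simpa using this
  have hc : p.snd.snd = f p.fst / g p.fst :=
    tendsto_nhds_unique t3 (((hf.tendsto _).comp t1).div ((hg.tendsto _).comp t1) (hXg hmem))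
  refine ⟨hmem, ?_, .of_tendsto t4 ((hh₂.tendsto _).comp t4) t2 fun k => S.sub_z _, t1, t4, t2⟩
  rw [← hc]
  rfl

theorem mem_frechetSubdiff (hf : Continuous f) (hg : Differentiable ℝ g)
    (hh₁ : Differentiable ℝ h₁) (hXg : X ⊆ Omega g) (hXC : X ⊆ C) (k : ℕ) :
    mk3 (w k - (f (x (k + 1)) / g (x (k + 1))) ^ 2 • gradient g (x (k + 1)) +
      gradient h₁ (x (k + 1)) - z k) (x k - x (k + 1)) 0 ∈
    frechetSubdiff (auxH3 f g h₁ h₂ C)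
      (mk3 (x (k + 1)) (z k) (f (x (k + 1)) / g (x (k + 1)))) :=
  mem_frechetSubdiff_auxH3 hf hg hh₁ (hXC (S.mem _))
    (div_mul_cancel₀ _ (hXg (S.mem (k + 1)))).symm (S.sub_w k) (S.sub_z k)

theorem norm_frechetSubgradient_le (k : ℕ) :
    ‖mk3 (w k - (f (x (k + 1)) / g (x (k + 1))) ^ 2 • gradient g (x (k + 1)) +
      gradient h₁ (x (k + 1)) - z k) (x k - x (k + 1)) 0‖ ≤ (M + 1) * ‖x (k + 1) - x k‖ := by
  refine (norm_mk3_le _ _).trans ?_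
  rw [norm_sub_rev (x k)]
  linarith [S.error k]

theorem auxH3_eq (hXg : X ⊆ Omega g) (hXC : X ⊆ C) (k : ℕ) :
    auxH3 f g h₁ h₂ C (mk3 (x (k + 1)) (z k) (f (x (k + 1)) / g (x (k + 1)))) =
      (modelValue f g h₁ h₂ (x k) (x (k + 1)) (z k) : ℝ) :=
  auxH_eq_modelValue (hXg (S.mem _)) (hXC (S.mem _)) (S.sub_z k)

theorem exists_isCompact {K c : ℝ} (hX : IsCompact X) (hz : ∀ k, ‖z k‖ ≤ K)
    (hc : ∀ y ∈ X, f y / g y ∈ Set.Icc 0 c) :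
    ∃ T : Set (E3 n), IsCompact T ∧
      ∀ k, mk3 (x (k + 1)) (z k) (f (x (k + 1)) / g (x (k + 1))) ∈ T :=
  ⟨_, (hX.prod ((isCompact_closedBall (0 : E n) K).prod isCompact_Icc)).image continuous_mk3,
    fun k => ⟨(x (k + 1), z k, f (x (k + 1)) / g (x (k + 1))),
      ⟨S.mem _, mem_closedBall_zero_iff.2 (hz k), hc _ (S.mem _)⟩, rfl⟩⟩

/-- The error tends to zero and all its other terms converge, so `w` converges along the
subsequence; the subgradient inequality is closed under limits. -/
theorem isCriticalPoint_of_tendsto (hf : Continuous f) (hg : Continuous g)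
    (hgc : Continuous (gradient g)) (hh₁c : Continuous (gradient h₁)) (hXg : X ⊆ Omega g)
    (hXC : X ⊆ C) (hd : Tendsto (fun k => ‖x (k + 1) - x k‖) atTop (𝓝 0)) {φ : ℕ → ℕ}
    (hφ : StrictMono φ) {y z' : E n} (hy : y ∈ X)
    (hx : Tendsto (fun k => x (φ k + 1)) atTop (𝓝 y))
    (hz : Tendsto (fun k => z (φ k)) atTop (𝓝 z')) (hz' : HasSubgradientOn h₂ Set.univ z' y) :
    IsCriticalPoint f g h₁ h₂ C y := by
  have tc : Tendsto (fun k => f (x (φ k + 1)) / g (x (φ k + 1))) atTop (𝓝 (f y / g y)) :=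
    ((hf.tendsto _).comp hx).div ((hg.tendsto _).comp hx) (hXg hy)
  have te : Tendsto (fun k => w (φ k) - (f (x (φ k + 1)) / g (x (φ k + 1))) ^ 2 •
      gradient g (x (φ k + 1)) + gradient h₁ (x (φ k + 1)) - z (φ k)) atTop (𝓝 0) := by
    refine squeeze_zero_norm (fun k => S.error (φ k)) ?_
    simpa using (hd.comp hφ.tendsto_atTop).const_mul M
  have tw : Tendsto (fun k => w (φ k)) atTop
      (𝓝 ((f y / g y) ^ 2 • gradient g y - gradient h₁ y + z')) := by
    have := te.add ((((tc.pow 2).smul ((hgc.tendsto _).comp hx)).sub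
      ((hh₁c.tendsto _).comp hx)).add hz)
    rw [zero_add] at this
    refine this.congr fun k => ?_
    simp only [Function.comp_apply]
    abel
  refine ⟨⟨hXg hy, hXC hy⟩, (f y / g y) ^ 2 • gradient g y - gradient h₁ y + z',
    mem_limitingSubdiff_scaledPlusIndicator (hXC hy) ?_, z',
    mem_realSubdiff_of_hasSubgradientOn hz', ?_⟩
  · intro u hu
    refine le_of_tendsto_of_tendsto (((tc.const_mul 2).mul ((hf.tendsto _).comp hx)).add
      (tw.inner (tendsto_const_nhds.sub hx))) ((tc.const_mul 2).mul_const (f u))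
      (Eventually.of_forall fun k => S.sub_w (φ k) u hu)
  · abel

theorem exists_tendsto_isCriticalPoint (hf : Continuous f) (hg : Differentiable ℝ g)
    (hgc : Continuous (gradient g)) (hh₁ : Differentiable ℝ h₁)
    (hh₁c : Continuous (gradient h₁)) (hh₂ : Continuous h₂) (hσ : 0 < σ) (hM : 0 < M)
    (hX : IsCompact X) (hXg : X ⊆ Omega g) (hXC : X ⊆ C) {K c : ℝ} (hz : ∀ k, ‖z k‖ ≤ K)
    (hc : ∀ y ∈ X, f y / g y ∈ Set.Icc 0 c) (hKL : IsKLFunction (auxH3 f g h₁ h₂ C)) :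
    ∃ y, Tendsto x atTop (𝓝 y) ∧ IsCriticalPoint f g h₁ h₂ C y := by
  obtain ⟨l, hl⟩ := S.exists_tendsto_modelValue hf hg.continuous hh₁.continuous hh₂ hσ hX hXg
  have hd := S.tendsto_norm_sub hσ hl
  obtain ⟨T, hT, hζ⟩ := S.exists_isCompact hX hz hc
  have hsum : Summable fun k => ‖x (k + 1) - x k‖ := by
    refine summable_of_forall_cluster_KLPropertyAt (φ := auxH3 f g h₁ h₂ C) (s := σ / 2)
      (M := M + 1) hT hζ (S.auxH3_eq hXg hXC) hl (fun k => norm_nonneg _) (by positivity)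
      (by positivity) S.modelValue_succ_le (fun k => ?_) (fun p hp => ?_)
    · refine (Metric.infEDist_le_edist_of_mem (mem_limitingSubdiff_of_mem_frechetSubdiff
        (S.mem_frechetSubdiff hf hg hh₁ hXg hXC k))).trans ?_
      rw [edist_dist, dist_zero_left]
      exact ENNReal.ofReal_le_ofReal (S.norm_frechetSubgradient_le k)
    · obtain ⟨φ, hφ, hp⟩ := MapClusterPt.tendsto_subseq hp
      obtain ⟨hX', e, hz', t1, t2, t3⟩ := S.limit_of_tendsto hf hg.continuous hh₂ hX hXg hd hφ hp
      have hval : auxH3 f g h₁ h₂ C p = (l : ℝ) := by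
        have hm := (continuousAt_modelValue hf hg.continuous hh₁.continuous hh₂
          (x := p.fst) (z := p.snd.fst) (hXg hX')).tendsto.comp
            (t2.prodMk_nhds (t1.prodMk_nhds t3))
        have : modelValue f g h₁ h₂ p.fst p.fst p.snd.fst = l :=
          tendsto_nhds_unique hm (hl.comp hφ.tendsto_atTop)
        rw [← this, e]
        exact auxH_eq_modelValue (hXg hX') (hXC hX') hz'
      -- The KL property is granted only where the limiting subdifferential is nonempty; here it
      -- contains `0`, the limit of the Fréchet subgradients along the subsequence.
      refine ⟨hval, hKL.2 p ⟨0, by rw [hval]; exact EReal.coe_lt_top l, _, _, hp, ?_, ?_,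
        fun k => S.mem_frechetSubdiff hf hg hh₁ hXg hXC (φ k)⟩⟩
      · rw [hval]
        refine (EReal.tendsto_coe.2 (hl.comp hφ.tendsto_atTop)).congr fun k => ?_
        exact (S.auxH3_eq hXg hXC (φ k)).symm
      · refine squeeze_zero_norm (fun k => S.norm_frechetSubgradient_le (φ k)) ?_
        simpa using (hd.comp hφ.tendsto_atTop).const_mul (M + 1)
  obtain ⟨y, hy⟩ := cauchySeq_tendsto_of_complete (cauchySeq_of_summable_dist (f := x)
    (by simpa only [dist_eq_norm, norm_sub_rev] using hsum))
  refine ⟨y, hy, ?_⟩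
  -- The subgradients `z k` need not converge, so a subsequence is taken; its `x`-limit is `y`.
  obtain ⟨p, -, φ, hφ, hp⟩ := hT.tendsto_subseq hζ
  obtain ⟨hX', e, hz', t1, t2, t3⟩ := S.limit_of_tendsto hf hg.continuous hh₂ hX hXg hd hφ hp
  obtain rfl : y = p.fst := tendsto_nhds_unique (hy.comp hφ.tendsto_atTop) t2
  exact S.isCriticalPoint_of_tendsto hf hg.continuous hgc hh₁c hXg hXC hd hφ hX' t1 t3 hz'

end DescentSequence

end FracProg

/-! ### Runs of the algorithm: stepsizes and descent. -/

namespace FracProg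

variable {n : ℕ} {f g h₁ h₂ : E n → ℝ} {C : Set (E n)} {αlo αhi σ r : ℝ}
  {x z : ℕ → E n} {c αinit : ℕ → ℝ} {m : ℕ → ℕ} {xhat : ℕ → ℕ → E n}

theorem levelSet_subset (x₀ : E n) : levelSet f g h₁ h₂ C x₀ ⊆ Omega g ∩ C :=
  fun _ hx => mem_of_objective_lt_top hx.1

/-- Below a fixed threshold every stepsize passes the acceptance test. -/
theorem UniformBounds.exists_forall_accepts {X : Set (E n)} {R K η : ℝ}
    (B : UniformBounds f g h₁ h₂ X R K η) (hf : ∀ x, 0 ≤ f x)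
    (hf_convex : ConvexOn ℝ Set.univ f) (hg : Differentiable ℝ g) (hh₁ : Differentiable ℝ h₁)
    (hσ : 0 < σ) (hXC : X ⊆ C) :
    ∃ α₀ : ℝ, 0 < α₀ ∧ ∀ (x z y : E n) (α : ℝ), x ∈ X → HasSubgradientOn h₂ Set.univ z x →
      0 < α → α ≤ α₀ →
      y ∈ prox (scaledPlusIndicator (2 * α * (f x / g x)) f C)
        (x - α • (gradient h₁ x - (f x / g x) ^ 2 • gradient g x - z)) →
      Accepts f g h₁ h₂ C σ x z y := by
  have hK := B.K_pos
  have hη := B.η_pos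
  -- `K₁` is the constant of `norm_step_le` with the bound of `norm_direction_le` as `D`, and `K₂`
  -- is the left side of `hαρ` in `accepts_of_small`.
  set K₁ := 2 * (2 * (K / η) * K + (2 + (K / η) ^ 2) * K) with hK₁
  set K₂ := (K / η) ^ 2 * K + K + ((1 + K / η) * K) ^ 2 / (η / 2) + σ / 2 with hK₂
  have p₁ : 0 < K₁ := by positivity
  have p₂ : 0 < K₂ := by positivity
  -- With step length at most `α K₁`, the three thresholds ensure step length at most `1`, `g y ≥ η
  -- / 2`, and `K₂ ≤ 1 / (2α)`.
  refine ⟨min (1 / K₁) (min (η / 2 / (K * K₁)) (1 / (2 * K₂))), by positivity, ?_⟩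
  intro x z y α hx hz hα hle hy
  obtain ⟨l₁, l₂, l₃⟩ : α ≤ 1 / K₁ ∧ α ≤ η / 2 / (K * K₁) ∧ α ≤ 1 / (2 * K₂) := by
    simpa only [le_min_iff] using hle
  have hyC := mem_of_mem_prox_scaledPlusIndicator ⟨x, hXC hx⟩ hy
  have hprox := prox_step_le hα (hXC hx) hyC hy
  have hstep := B.norm_step_le hf hf_convex hα hx (B.norm_direction_le hf hx hz) hprox
  refine B.accepts_of_small hf hg hh₁ hx (hXC hx) hyC hz hprox hstep ?_ ?_ ?_
  · rwa [le_div_iff₀ p₁] at l₁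
  · rw [le_div_iff₀ (by positivity)] at l₂
    linarith
  · rw [← hK₂, le_div_iff₀ (by positivity)]
    rw [le_div_iff₀ (by positivity)] at l₃
    linarith

namespace IsRun

variable (H : IsRun f g h₁ h₂ C αlo αhi σ r x z c αinit m xhat)
include H

theorem hasSubgradientOn_z (hh₂ : ConvexOn ℝ Set.univ h₂) (k : ℕ) :
    HasSubgradientOn h₂ Set.univ (z k) (x k) :=
  hasSubgradientOn_of_mem_realSubdiff hh₂ (H.z_mem k)

theorem next_mem_prox (k : ℕ) :
    x (k + 1) ∈ prox (scaledPlusIndicator (2 * (αinit k * r ^ m k) * (f (x k) / g (x k))) f C)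
      (x k - (αinit k * r ^ m k) • (gradient h₁ (x k) -
        (f (x k) / g (x k)) ^ 2 • gradient g (x k) - z k)) := by
  have h := H.trial k (m k) le_rfl
  rwa [← H.next, H.c_eq] at h

theorem next_mem (hC : C.Nonempty) (k : ℕ) : x (k + 1) ∈ Omega g ∩ C :=
  ⟨H.next k ▸ (H.accepted k).1, mem_of_mem_prox_scaledPlusIndicator hC (H.next_mem_prox k)⟩

theorem mem_dom (hC : C.Nonempty) (k : ℕ) : x k ∈ Omega g ∩ C := by
  cases k with
  | zero => exact mem_of_objective_lt_top H.init_mem_dom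
  | succ k => exact H.next_mem hC k

theorem modelValue_le (hC : C.Nonempty) (hh₂ : ConvexOn ℝ Set.univ h₂) (k : ℕ) :
    modelValue f g h₁ h₂ (x k) (x (k + 1)) (z k) + σ / 2 * ‖x (k + 1) - x k‖ ^ 2 ≤
      realObjective f g h₁ h₂ (x k) := by
  have h := (H.accepted k).2
  have hm := H.next_mem hC k
  rw [← H.next, auxH_eq_modelValue hm.1 hm.2 (H.hasSubgradientOn_z hh₂ k),
    objective_of_mem (H.mem_dom hC k), ← EReal.coe_add, EReal.coe_le_coe_iff] at h
  exact h

theorem mem_levelSet (hC : C.Nonempty) (hσ : 0 < σ) (hh₂ : ConvexOn ℝ Set.univ h₂) (k : ℕ) :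
    x k ∈ levelSet f g h₁ h₂ C (x 0) := by
  induction k with
  | zero => exact ⟨H.init_mem_dom, le_rfl⟩
  | succ k ih =>
    have hm := H.next_mem hC k
    refine ⟨by rw [objective_of_mem hm]; exact EReal.coe_lt_top _, le_trans ?_ ih.2⟩
    rw [objective_of_mem hm, objective_of_mem (H.mem_dom hC k), EReal.coe_le_coe_iff]
    have h1 := H.modelValue_le hC hh₂ k
    have h2 := realObjective_le_modelValue (f := f) (g := g) (h₁ := h₁) (y := x (k + 1))
      (H.hasSubgradientOn_z hh₂ k)
    have : 0 ≤ σ / 2 * ‖x (k + 1) - x k‖ ^ 2 := by positivity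
    simp only [realObjective] at h1 h2
    linarith

/-- The accepted stepsizes are bounded away from zero. -/
theorem exists_le_stepsize {R K η : ℝ}
    (B : UniformBounds f g h₁ h₂ (levelSet f g h₁ h₂ C (x 0)) R K η) (hf : ∀ x, 0 ≤ f x)
    (hf_convex : ConvexOn ℝ Set.univ f) (hg : Differentiable ℝ g) (hh₁ : Differentiable ℝ h₁)
    (hh₂ : ConvexOn ℝ Set.univ h₂) (hC : C.Nonempty) (hαlo : 0 < αlo) (hσ : 0 < σ) (hr : 0 < r) :
    ∃ a : ℝ, 0 < a ∧ ∀ k, a ≤ αinit k * r ^ m k := by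
  obtain ⟨α₀, hα₀, hacc⟩ := B.exists_forall_accepts hf hf_convex hg hh₁ hσ
    (fun y hy => (levelSet_subset _ hy).2)
  -- Either the initial stepsize, at least `αlo`, is accepted, or the last rejected one exceeds `α₀`
  -- and the accepted one is `r` times it.
  refine ⟨min αlo (α₀ * r), by positivity, fun k => ?_⟩
  have hα := (H.αinit_mem k).1
  cases hm : m k with
  | zero => simpa using Or.inl hα
  | succ j =>
    have hj : j < m k := by omega
    have hpos : 0 < αinit k * r ^ j := mul_pos (hαlo.trans_le hα) (pow_pos hr j)
    have hlt : α₀ < αinit k * r ^ j := by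
      by_contra! hle
      have ht := H.trial k j hj.le
      rw [H.c_eq] at ht
      exact H.rejected k j hj (hacc _ _ _ _ (H.mem_levelSet hC hσ hh₂ k)
        (H.hasSubgradientOn_z hh₂ k) hpos hle ht)
    refine (min_le_right _ _).trans ?_
    rw [pow_succ, ← mul_assoc]
    gcongr

theorem exists_descentSequence {R K η : ℝ}
    (B : UniformBounds f g h₁ h₂ (levelSet f g h₁ h₂ C (x 0)) R K η) (hf : ∀ x, 0 ≤ f x)
    (hf_convex : ConvexOn ℝ Set.univ f) (hg : Differentiable ℝ g) (hh₁ : Differentiable ℝ h₁)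
    (hh₂ : ConvexOn ℝ Set.univ h₂) (hC : C.Nonempty) (hC_convex : Convex ℝ C) (hαlo : 0 < αlo)
    (hσ : 0 < σ) (hr : 0 < r) :
    ∃ M w, 0 < M ∧
      DescentSequence f g h₁ h₂ C (levelSet f g h₁ h₂ C (x 0)) σ M x z w := by
  obtain ⟨a, ha, hstep⟩ := H.exists_le_stepsize B hf hf_convex hg hh₁ hh₂ hC hαlo hσ hr
  have hmem := H.mem_levelSet hC hσ hh₂
  have hw := fun k => B.exists_subgradient_norm_le (z := z k) hf hf_convex hC_convex ha (hstep k)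
    (hmem k) (hmem (k + 1)) (H.next_mem hC k).2
    (hasSubgradientOn_of_mem_prox hf_convex hC_convex (ha.trans_le (hstep k))
      (B.ratio_nonneg hf (hmem k)) (H.next_mem hC k).2 (H.next_mem_prox k))
  choose w hw₁ hw₂ using hw
  have hK := B.K_pos
  have hη := B.η_pos
  exact ⟨_, w, by positivity,
    { mem := hmem
      sub_z := H.hasSubgradientOn_z hh₂
      sub_w := hw₁
      error := hw₂
      descent := H.modelValue_le hC hh₂ }⟩

end IsRun

end FracProg

theorem mainTheorem3 (n : ℕ)
    (f g h₁ h₂ : EuclideanSpace ℝ (Fin n) → ℝ) (C : Set (EuclideanSpace ℝ (Fin n)))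
    (hf_nonneg : ∀ x, 0 ≤ f x) (hg_nonneg : ∀ x, 0 ≤ g x)
    (hC_closed : IsClosed C) (hC_convex : Convex ℝ C)
    (hC_nonempty : (C ∩ FracProg.Omega g).Nonempty)
    (hf_convex : ConvexOn ℝ Set.univ f)
    (hg_diff : Differentiable ℝ g) (hg_lip : LocallyLipschitz (gradient g))
    (hh₁_diff : Differentiable ℝ h₁) (hh₁_lip : LocallyLipschitz (gradient h₁))
    (hh₂_convex : ConvexOn ℝ Set.univ h₂)
    (αlo αhi σ r : ℝ) (hαlo : 0 < αlo) (hαhi : αlo < αhi) (hσ : 0 < σ) (hr₀ : 0 < r) (hr₁ : r < 1)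
    (x : ℕ → EuclideanSpace ℝ (Fin n))
    (hx : FracProg.IsGenerated f g h₁ h₂ C αlo αhi σ r x)
    (hlevel : IsCompact (FracProg.levelSet f g h₁ h₂ C (x 0)))
    (hH_closed : FracProg.IsProperClosed (FracProg.auxH3 f g h₁ h₂ C))
    (hH_KL : FracProg.IsKLFunction (FracProg.auxH3 f g h₁ h₂ C)) :
    ∃ xstar : EuclideanSpace ℝ (Fin n),
      Tendsto x atTop (𝓝 xstar) ∧ FracProg.IsCriticalPoint f g h₁ h₂ C xstar := by
  obtain ⟨z, c, αinit, m, xhat, H⟩ := hx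
  have hXg : FracProg.levelSet f g h₁ h₂ C (x 0) ⊆ FracProg.Omega g :=
    fun y hy => (FracProg.levelSet_subset _ hy).1
  obtain ⟨R, K, η, B⟩ := FracProg.exists_uniformBounds hf_convex hg_nonneg hg_diff hg_lip hh₁_lip
    hh₂_convex hlevel hXg
  obtain ⟨M, w, hM, S⟩ := H.exists_descentSequence B hf_nonneg hf_convex hg_diff hh₁_diff
    hh₂_convex hC_nonempty.left hC_convex hαlo hσ hr₀
  exact S.exists_tendsto_isCriticalPoint hf_convex.locallyLipschitz.continuous hg_diff
    hg_lip.continuous hh₁_diff hh₁_lip.continuous hh₂_convex.locallyLipschitz.continuous hσ hM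
    hlevel hXg (fun y hy => (FracProg.levelSet_subset _ hy).2)
    (fun k => B.norm_le_of_hasSubgradientOn B.h₂_lip (S.mem k) (S.sub_z k))
    (fun y hy => ⟨B.ratio_nonneg hf_nonneg hy, B.ratio_le hy⟩) hH_KL
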